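/- Let $G$ be a discrete group, not necessarily finite. Let $\mathcal{O}_G$ be the orbit category (objects: coset spaces $G/H$ for all subgroups $H\le G$; morphisms: $G$-maps), $\mathbf{Cat}$ the category of small categories, and $\mathbf{Cat}^G$ the category of small categories with $G$-action and strictly equivariant functors ($G$-functors). *Functors.* For a $G$-category $\mathcal{A}$, the presheaf $\Phi\mathcal{A}:\mathcal{O}_G^{op}\to\mathbf{Cat}$ sends $G/H$ to the category $\mathrm{Fun}^G(G/H,\mathcal{A})$ of $G$-functors and $G$-natural transformations out of the discrete $G$-category $G/H$; evaluation at $eH$ identifies it with the subcategory $\mathcal{A}^H$ of $H$-fixed objects and morphisms. For $X:\mathcal{O}_G^{op}\to\mathbf{Cat}$, the $G$-category $CX$ has as objects the triples $(G/H,aH,x)$ with $aH\in G/H$ and $x\in X(G/H)$; a morphism $(G/H,aH,x)\to(G/K,bK,y)$ is a pair $(f,h)$ of a $G$-map $f:G/K\to G/H$ with $f(bK)=aH$ and a morphism $h:f^*x\to y$ in $X(G/K)$, where $f^*=X(f)$; composition is that of the Grothendieck construction; $G$ acts by $g(G/H,aH,x)=(G/H,gaH,x)$, $g(f,h)=(f,h)$.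 A natural transformation $\lambda : X\Rightarrow Y$ induces $(G/H,aH,x)\mapsto(G/H,aH,\lambda x)$, $(f,h)\mapsto(f,\lambda h)$. *Weak equivalences.* Let $B$ be the classifying space functor (geometric realization of the nerve). A map of presheaves is a weak equivalence if $B$ of each of its components is a weak homotopy equivalence. A $G$-functor $F$ is a weak equivalence if $(BF)^H$ is a weak homotopy equivalence for every subgroup $H\le G$, where $(-)^H$ is the subspace of $H$-fixed points. **Theorem.** The functors $C:\mathrm{Fun}(\mathcal{O}_G^{op},\mathbf{Cat})\rightleftarrows\mathbf{Cat}^G:\Phi$ are inverse up to natural weak equivalence. More precisely, there are natural transformations $\varepsilon:\Phi\circ C\Rightarrow\mathrm{id}$ and $\mathrm{ev}:C\circ\Phi\Rightarrow\mathrm{id}$ with the following properties. 1. For every $X$ and every subgroup $L\le G$, the component $\varepsilon_L:(CX)^L\to X(G/L)$ is given by $\varepsilon_L(G/H,aH,x)=r_a^*x$ and, for $(f,h):(G/H,aH,x)\to(G/K,bK,y)$, by $\varepsilon_L(f,h)=r_b^*h$, where $r_a:G/L\to G/H$ and $r_b:G/L\to G/K$ are the $G$-maps with $r_a(eL)=aH$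 and $r_b(eL)=bK$. 2. Each $\varepsilon_X:\Phi CX\Rightarrow X$ is a (levelwise) weak equivalence. Moreover, for every $X$ and $L$ the formulas $\eta_L(x)=(G/L,eL,x)$, $\eta_L(f)=(\mathrm{id},f)$ define a functor $\eta_L:X(G/L)\to(CX)^L$ such that $\varepsilon_L\circ\eta_L=\mathrm{id}$, the maps $(r_a,\mathrm{id}):(G/H,aH,x)\to(G/L,eL,r_a^*x)$ form a natural transformation $\mathrm{id}\Rightarrow\eta_L\circ\varepsilon_L$, and $B\varepsilon_L$ and $B\eta_L$ are mutually inverse homotopy equivalences. 3. For every $G$-category $\mathcal{A}$, the $G$-functor $\mathrm{ev}_{\mathcal{A}}:C\Phi\mathcal{A}\to\mathcal{A}$ is given by $\mathrm{ev}(G/H,aH,x)=ax$ and, for $(f,h):(G/H,aH,x)\to(G/K,bK,y)$, by $\mathrm{ev}(f,h)=bh$, and it is a weak equivalence of $G$-categories. 4. $\Phi(\mathrm{ev}_{\mathcal{A}})=\varepsilon_{\Phi\mathcal{A}}$ for every $G$-category $\mathcal{A}$. -/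

import Mathlib

open CategoryTheory Opposite
open scoped Topology

universe u

namespace Elmendorf

/-! ## Weak homotopy equivalences -/

section Spaces

variable {X Y : Type u} [TopologicalSpace X] [TopologicalSpace Y]

/-- The map on path components induced by a continuous map. -/
def zerothHomotopyMap (f : C(X, Y)) : ZerothHomotopy X → ZerothHomotopy Y :=
  ZerothHomotopy.lift (fun x => ZerothHomotopy.mk (f x))
    (fun _ _ p => ZerothHomotopy.sound (p.map f.continuous))

/-- Postcomposition of an `n`-dimensional loop with a continuous map. -/
def genLoopMap (f : C(X, Y)) (n : ℕ) (x : X) (γ : GenLoop (Fin n) X x) :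
    GenLoop (Fin n) Y (f x) :=
  ⟨f.comp γ.1, fun t ht => congrArg f (γ.2 t ht)⟩

/-- The map on `n`-th homotopy groups induced by a continuous map. -/
def homotopyGroupMap (f : C(X, Y)) (n : ℕ) (x : X) : π_ n X x → π_ n Y (f x) :=
  Quotient.map (genLoopMap f n x) (fun _ _ h => h.map (fun F => F.compContinuousMap f))

/-- A weak homotopy equivalence: a map that is bijective on path components and on all homotopy
groups in degrees at least one, for all base points. -/
structure IsWeakHomotopyEquiv (f : C(X, Y)) : Prop where
  bijective_zerothHomotopy : Function.Bijective (zerothHomotopyMap f)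
  bijective_homotopyGroup :
    ∀ (n : ℕ) (x : X), 1 ≤ n → Function.Bijective (homotopyGroupMap f n x)

end Spaces

/-! ## Classifying spaces and weak equivalences -/

/-- The classifying space functor: the geometric realization of the nerve. -/
noncomputable def classifyingSpace : Cat.{u, u} ⥤ TopCat.{u} :=
  nerveFunctor ⋙ SSet.toTop

section GSpaces

variable {G : Type u} [Group G]

/-- The self-map of a `G`-space given by acting with `g`. -/
def spaceAct (X : Action TopCat.{u} G) (g : G) : C(X.V, X.V) :=
  TopCat.Hom.hom (X := X.V) (Y := X.V) (X.ρ g)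

/-- The subspace of `H`-fixed points of a `G`-space. -/
abbrev FixedSpace (X : Action TopCat.{u} G) (H : Subgroup G) : Type u :=
  {x : X.V // ∀ h ∈ H, spaceAct X h x = x}

lemma hom_spaceAct {X Y : Action TopCat.{u} G} (f : X ⟶ Y) (g : G) (x : X.V) :
    spaceAct Y g (f.hom.hom x) = f.hom.hom (spaceAct X g x) :=
  (congrArg (fun k : X.V ⟶ Y.V => k.hom x) (f.comm g)).symm

/-- The map on `H`-fixed points induced by a `G`-map. -/
def fixedMap {X Y : Action TopCat.{u} G} (f : X ⟶ Y) (H : Subgroup G) :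
    C(FixedSpace X H, FixedSpace Y H) where
  toFun x := ⟨f.hom.hom x.1, fun h hh => by rw [hom_spaceAct, x.2 h hh]⟩
  continuous_toFun := by
    exact (f.hom.hom.continuous.comp continuous_subtype_val).subtype_mk _

/-- A weak equivalence of `G`-spaces: a `G`-map that is a weak homotopy equivalence on `H`-fixed
points for every subgroup `H` of `G`. -/
def IsWeakGEquiv {X Y : Action TopCat.{u} G} (f : X ⟶ Y) : Prop :=
  ∀ H : Subgroup G, IsWeakHomotopyEquiv (fixedMap f H)

end GSpaces

/-! ## `G`-categories

A small `G`-category is an object of `Action Cat.{u, u} G`, and a `G`-functor is a morphism there. -/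

section GCategories

variable {G : Type u} [Group G]

/-- The functor `g · (-)` on a `G`-category. -/
abbrev act (A : Action Cat.{u, u} G) (g : G) : A.V ⥤ A.V :=
  Cat.Hom.toFunctor (C := A.V) (D := A.V) (A.ρ g)

/-- A weak equivalence of `G`-categories: a `G`-functor whose classifying map is a weak equivalence
of `G`-spaces. -/
def IsWeakEquivGCat {A B : Action Cat.{u, u} G} (F : A ⟶ B) : Prop :=
  IsWeakGEquiv ((classifyingSpace.mapAction G).map F)

/-- The type of `G`-functors from `A` to `B`. -/
def GFun (A B : Action Cat.{u, u} G) : Type u := A ⟶ B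

/-- The functor underlying a `G`-functor. -/
abbrev GFun.functor {A B : Action Cat.{u, u} G} (F : GFun A B) : A.V ⥤ B.V :=
  Cat.Hom.toFunctor (Action.Hom.hom F)

lemma GFun.comm {A B : Action Cat.{u, u} G} (F : GFun A B) (g : G) :
    act A g ⋙ F.functor = F.functor ⋙ act B g :=
  congrArg Cat.Hom.toFunctor (Action.Hom.comm F g)

/-- A `G`-natural transformation: a natural transformation `η` with `g η_a = η_{g a}`. -/
@[ext]
structure GNatTrans {A B : Action Cat.{u, u} G} (F F' : GFun A B) : Type u where
  nat : F.functor ⟶ F'.functor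
  equivariant : ∀ (g : G) (a : A.V),
    HEq ((act B g).map (nat.app a)) (nat.app ((act A g).obj a))

lemma heq_comp {C : Type*} [Category* C] {X Y Z X' Y' Z' : C} (hX : X = X') (hY : Y = Y')
    (hZ : Z = Z') {f : X ⟶ Y} {g : Y ⟶ Z} {f' : X' ⟶ Y'} {g' : Y' ⟶ Z'} (hf : HEq f f')
    (hg : HEq g g') : HEq (f ≫ g) (f' ≫ g') := by
  subst hX hY hZ
  cases hf
  cases hg
  rfl

lemma GFun.obj_act {A B : Action Cat.{u, u} G} (F : GFun A B) (g : G) (a : A.V) :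
    (act B g).obj (F.functor.obj a) = F.functor.obj ((act A g).obj a) :=
  (Functor.congr_obj (F.comm g) a).symm

lemma GFun.map_act {A B : Action Cat.{u, u} G} (F : GFun A B) (g : G) {a b : A.V} (f : a ⟶ b) :
    HEq ((act B g).map (F.functor.map f)) (F.functor.map ((act A g).map f)) := by
  have h := F.comm g
  exact (Functor.hcongr_hom h f).symm

lemma functor_map_heq {C D : Type*} [Category* C] [Category* D] (F : C ⥤ D) {X Y X' Y' : C}
    (hX : X = X') (hY : Y = Y') {f : X ⟶ Y} {f' : X' ⟶ Y'} (h : HEq f f') :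
    HEq (F.map f) (F.map f') := by
  subst hX hY
  cases h
  rfl

/-- The category of `G`-functors and `G`-natural transformations. -/
instance (A B : Action Cat.{u, u} G) : Category.{u} (GFun A B) where
  Hom F F' := GNatTrans F F'
  id F := ⟨𝟙 F.functor, fun g a => by
    have key : ∀ {x y : B.V}, x = y → HEq (𝟙 x) (𝟙 y) := by
      rintro x _ rfl
      rfl
    exact (heq_of_eq ((act B g).map_id _)).trans (key (F.obj_act g a))⟩
  comp {F F' F''} η θ := ⟨η.nat ≫ θ.nat, fun g a => by
    simp only [NatTrans.comp_app, Functor.map_comp]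
    exact heq_comp (F.obj_act g a) (F'.obj_act g a) (F''.obj_act g a)
      (η.equivariant g a) (θ.equivariant g a)⟩
  id_comp η := GNatTrans.ext (Category.id_comp _)
  comp_id η := GNatTrans.ext (Category.comp_id _)
  assoc η θ κ := GNatTrans.ext (Category.assoc _ _ _)

/-- Precomposition with a `G`-functor. -/
def precomp {A A' : Action Cat.{u, u} G} (P : A' ⟶ A) (B : Action Cat.{u, u} G) :
    GFun A B ⥤ GFun A' B where
  obj F := P ≫ (show A ⟶ B from F)
  map {F F'} η := ⟨Functor.whiskerLeft P.hom.toFunctor η.nat, fun g a => by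
    have h : (act A g).obj (P.hom.toFunctor.obj a) = P.hom.toFunctor.obj ((act A' g).obj a) :=
      GFun.obj_act P g a
    have e := η.equivariant g (P.hom.toFunctor.obj a)
    rw [h] at e
    exact e⟩
  map_id _ := rfl
  map_comp _ _ := rfl

/-- Postcomposition with a `G`-functor. -/
def postcomp (A : Action Cat.{u, u} G) {B B' : Action Cat.{u, u} G} (Q : B ⟶ B') :
    GFun A B ⥤ GFun A B' where
  obj F := (show A ⟶ B from F) ≫ Q
  map {F F'} η := ⟨Functor.whiskerRight η.nat Q.hom.toFunctor, fun g a =>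
    (GFun.map_act Q g (η.nat.app a)).trans
      (functor_map_heq Q.hom.toFunctor (F.obj_act g a) (F'.obj_act g a) (η.equivariant g a))⟩
  map_id F := GNatTrans.ext (by
    ext a
    exact Q.hom.toFunctor.map_id _)
  map_comp η θ := GNatTrans.ext (by
    ext a
    exact Q.hom.toFunctor.map_comp _ _)

variable (G) in
/-- The enriched hom functor `(A, B) ↦ Fun^G(A, B)`. -/
def funG : Action Cat.{u, u} G ⥤ (Action Cat.{u, u} G)ᵒᵖ ⥤ Cat.{u, u} where
  obj B :=
    { obj := fun A => Cat.of (GFun A.unop B)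
      map := fun P => (precomp P.unop B).toCatHom
      map_id := fun _ => rfl
      map_comp := fun _ _ => rfl }
  map Q :=
    { app := fun A => (postcomp A.unop Q).toCatHom
      naturality := fun _ _ _ => rfl }
  map_id _ := rfl
  map_comp _ _ := rfl

end GCategories

/-! ## The orbit category and the fixed point functor -/

section Orbits

variable (G : Type u) [Group G]

/-- The orbit category of `G`: its objects are the coset spaces `G/H`, for `H` a subgroup. -/
structure Orb : Type u where
  sub : Subgroup G

variable {G}

/-- The coset space `G/H` underlying an object of the orbit category. -/
abbrev Orb.Coset (H : Orb G) : Type u := G ⧸ H.sub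

/-- The morphisms of the orbit category are the `G`-maps. -/
instance : Category.{u} (Orb G) where
  Hom H K := H.Coset →[G] K.Coset
  id H := MulActionHom.id G
  comp f g := MulActionHom.comp g f

/-- The `G`-map underlying a morphism of the orbit category. -/
abbrev Orb.gmap {H K : Orb G} (f : H ⟶ K) : H.Coset →[G] K.Coset := f

/-- The coset `eH`. -/
abbrev Orb.one (H : Orb G) : H.Coset := ((1 : G) : G ⧸ H.sub)

/-- The `G`-map `r_a : G/L → G/H` with `r_a(eL) = aH`, where `aH` is an `L`-fixed coset. -/
def Orb.fromFixed (L : Orb G) {H : Orb G} (a : H.Coset) (ha : ∀ l ∈ L.sub, l • a = a) :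
    L ⟶ H where
  toFun c := Quotient.liftOn' c (fun g => g • a) (fun g g' h => by
    have h' := ha _ (QuotientGroup.leftRel_apply.mp h)
    calc g • a = g • ((g⁻¹ * g') • a) := by rw [h']
      _ = g' • a := by rw [smul_smul, mul_inv_cancel_left])
  map_smul' g c := by
    induction c using Quotient.inductionOn' with
    | h c => exact mul_smul g c a

/-- The discrete `G`-category on the orbit `G/H`. -/
def discObj (H : Orb G) : Action Cat.{u, u} G where
  V := Cat.of (Discrete H.Coset)
  ρ :=
    { toFun := fun g => (Discrete.functor (fun c : H.Coset => Discrete.mk (g • c))).toCatHom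
      map_one' := by
        refine Cat.ext (CategoryTheory.Functor.ext (fun c => Discrete.ext (one_smul G c.as)) ?_)
        intro c d _
        exact ULift.ext _ _ (Subsingleton.elim _ _)
      map_mul' := fun g g' => by
        refine Cat.ext (CategoryTheory.Functor.ext (fun c => Discrete.ext (mul_smul g g' c.as)) ?_)
        intros
        exact Subsingleton.elim (α := Discrete.mk _ ⟶ Discrete.mk _) _ _ }

variable (G) in
/-- The inclusion of the orbit category into `G`-categories, via discrete categories. -/
def disc : Orb G ⥤ Action Cat.{u, u} G where
  obj H := discObj H
  map {H K} f :=
    { hom := (Discrete.functor (fun c : H.Coset => Discrete.mk (Orb.gmap f c))).toCatHom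
      comm := fun g => by
        refine Cat.ext (CategoryTheory.Functor.ext (fun c => Discrete.ext (map_smul (Orb.gmap f) g c.as)) ?_)
        intros
        exact Subsingleton.elim (α := Discrete.mk _ ⟶ Discrete.mk _) _ _ }
  map_id H := by
    refine Action.Hom.ext (Cat.ext (CategoryTheory.Functor.ext (fun c => rfl) ?_))
    intros
    exact Subsingleton.elim (α := Discrete.mk _ ⟶ Discrete.mk _) _ _
  map_comp f g := by
    refine Action.Hom.ext (Cat.ext (CategoryTheory.Functor.ext (fun c => rfl) ?_))
    intros
    exact Subsingleton.elim (α := Discrete.mk _ ⟶ Discrete.mk _) _ _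

variable (G) in
/-- Presheaves of small categories on the orbit category. -/
abbrev OrbPsh := (Orb G)ᵒᵖ ⥤ Cat.{u, u}

variable (G) in
/-- The fixed point functor: `Φ A` sends `G/H` to `Fun^G(G/H, A)`, where `G/H` is regarded as a
discrete `G`-category. -/
def fixedPts : Action Cat.{u, u} G ⥤ OrbPsh G :=
  funG G ⋙ (Functor.whiskeringLeft _ _ _).obj (disc G).op

/-- Evaluation `Fun^G(G/L, A) ⥤ A` at the coset `eL`. It is an isomorphism onto the subcategory of
`L`-fixed objects and morphisms, and under this identification it is the inclusion `A^L ⊆ A`. -/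
def evalOne (A : Action Cat.{u, u} G) (L : Orb G) : ((fixedPts G).obj A).obj (op L) ⥤ A.V where
  obj y := (show GFun (discObj L) A from y).functor.obj (Discrete.mk L.one)
  map {y y'} φ := (show GNatTrans (A := discObj L) (B := A) y y' from φ).nat.app (Discrete.mk L.one)
  map_id _ := rfl
  map_comp _ _ := rfl

/-- A weak equivalence of presheaves: a natural transformation whose components have weak homotopy
equivalences as classifying maps. -/
def IsWeakEquivPsh {X Y : OrbPsh G} (t : X ⟶ Y) : Prop :=
  ∀ U : (Orb G)ᵒᵖ, IsWeakHomotopyEquiv (classifyingSpace.map (t.app U)).hom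

end Orbits

/-! ## The categorical Elmendorf construction -/

section Construction

variable (G : Type u) [Group G]

/-- Objects of the category of pointed orbits: pairs `(G/H, aH)`. -/
structure PtOrb : Type u where
  orb : Orb G
  pt : orb.Coset

variable {G}

/-- Morphisms `(G/H, aH) → (G/K, bK)` are the `G`-maps `f : G/H → G/K` with `f(aH) = bK`. -/
instance : Category.{u} (PtOrb G) where
  Hom P Q := {f : P.orb ⟶ Q.orb // Orb.gmap f P.pt = Q.pt}
  id P := ⟨𝟙 P.orb, rfl⟩
  comp f g := ⟨f.1 ≫ g.1, (congrArg (Orb.gmap g.1) f.2).trans g.2⟩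

variable (G) in
/-- The functor `(G/H, aH) ↦ G/H`. -/
def forgetPt : PtOrb G ⥤ Orb G where
  obj P := P.orb
  map f := f.1

/-- The Grothendieck construction of `(G/H, aH) ↦ X(G/H)`. Its objects are the triples
`(G/H, aH, x)` with `x` in `X(G/H)`; a morphism `(G/H, aH, x) → (G/K, bK, y)` is a pair `(f, h)` of
a `G`-map `f : G/K → G/H` with `f(bK) = aH` and a morphism `h : f^* x → y` in `X(G/K)`. -/
abbrev Elm (X : OrbPsh G) : Type u := Grothendieck ((forgetPt G).op ⋙ X)

/-- The triple `(G/H, aH, x)`. -/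
abbrev Elm.mk {X : OrbPsh G} (H : Orb G) (a : H.Coset) (x : X.obj (op H)) : Elm X :=
  ⟨op ⟨H, a⟩, x⟩

/-- The orbit `G/H` of a triple `(G/H, aH, x)`. -/
abbrev Elm.orb {X : OrbPsh G} (z : Elm X) : Orb G := z.base.unop.orb

/-- The coset `aH` of a triple `(G/H, aH, x)`. -/
abbrev Elm.pt {X : OrbPsh G} (z : Elm X) : z.orb.Coset := z.base.unop.pt

/-- The object `x` of a triple `(G/H, aH, x)`. -/
abbrev Elm.elt {X : OrbPsh G} (z : Elm X) : X.obj (op z.orb) := z.fiber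

/-- The `G`-map `f` of a morphism `(f, h)`. -/
abbrev Elm.homMap {X : OrbPsh G} {z w : Elm X} (φ : z ⟶ w) : w.orb ⟶ z.orb :=
  (Grothendieck.Hom.base φ).unop.1

/-- The morphism `h` of a morphism `(f, h)`. -/
abbrev Elm.homElt {X : OrbPsh G} {z w : Elm X} (φ : z ⟶ w) :
    (X.map (Elm.homMap φ).op).toFunctor.obj z.elt ⟶ w.elt :=
  Grothendieck.Hom.fiber φ

/-- The morphism `(f, h)`. -/
abbrev Elm.homMk {X : OrbPsh G} {H K : Orb G} {a : H.Coset} {b : K.Coset} {x : X.obj (op H)}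
    {y : X.obj (op K)} (f : K ⟶ H) (hf : Orb.gmap f b = a)
    (h : (X.map f.op).toFunctor.obj x ⟶ y) : Elm.mk H a x ⟶ Elm.mk K b y :=
  Grothendieck.Hom.mk (Quiver.Hom.op ⟨f, hf⟩) h

lemma Elm.homMk_heq {X : OrbPsh G} {H K : Orb G} {a a' : H.Coset} {b b' : K.Coset}
    {x : X.obj (op H)} {y : X.obj (op K)} (f : K ⟶ H) (hf : Orb.gmap f b = a)
    (hf' : Orb.gmap f b' = a') (h : (X.map f.op).toFunctor.obj x ⟶ y) (ha : a = a') (hb : b = b') :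
    HEq (Elm.homMk (x := x) (y := y) f hf h) (Elm.homMk (x := x) (y := y) f hf' h) := by
  subst ha hb
  rfl

/-- The functor `g · (-)`, with `g (G/H, aH, x) = (G/H, g a H, x)` and `g (f, h) = (f, h)`. -/
def Elm.smul (X : OrbPsh G) (g : G) : Elm X ⥤ Elm X where
  obj z := Elm.mk z.orb (g • z.pt) z.elt
  map {_ w} φ := Elm.homMk (Elm.homMap φ)
    ((map_smul (Orb.gmap (Elm.homMap φ)) g w.pt).trans
      (congrArg (g • ·) (Grothendieck.Hom.base φ).unop.2))
    (Elm.homElt φ)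
  map_id _ := rfl
  map_comp _ _ := rfl

/-- The `G`-category of triples `(G/H, aH, x)`. -/
def elmObj (X : OrbPsh G) : Action Cat.{u, u} G where
  V := Cat.of (Elm X)
  ρ :=
    { toFun := fun g => (Elm.smul X g).toCatHom
      map_one' := by
        refine Cat.ext (Functor.hext (fun z => ?_) (fun z w φ => ?_))
        · exact congrArg (fun a => Elm.mk z.orb a z.elt) (one_smul G z.pt)
        · exact Elm.homMk_heq _ _ (Grothendieck.Hom.base φ).unop.2 _ (one_smul G z.pt)
            (one_smul G w.pt)
      map_mul' := fun g g' => by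
        refine Cat.ext (Functor.hext (fun z => ?_) (fun z w φ => ?_))
        · exact congrArg (fun a => Elm.mk z.orb a z.elt) (mul_smul g g' z.pt)
        · exact Elm.homMk_heq _ _ _ _ (mul_smul g g' z.pt) (mul_smul g g' w.pt) }

variable (G) in
/-- The categorical Elmendorf construction. On morphisms `t : X ⟶ Y` it is given by
`(G/H, aH, x) ↦ (G/H, aH, t x)` and `(f, h) ↦ (f, t h)`. -/
def elm : OrbPsh G ⥤ Action Cat.{u, u} G where
  obj X := elmObj X
  map {X Y} t :=
    { hom := (Grothendieck.map (Functor.whiskerLeft (forgetPt G).op t)).toCatHom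
      comm := fun _ => by
        exact Cat.ext (Functor.hext (fun _ => rfl) (fun _ _ _ => HEq.rfl)) }
  map_id X := Action.Hom.ext (Cat.ext Grothendieck.map_id_eq)
  map_comp {X Y Z} s t := Action.Hom.ext (Cat.ext (Grothendieck.map_comp_eq
    (Functor.whiskerLeft (forgetPt G).op s) (Functor.whiskerLeft (forgetPt G).op t)))

/-- If `y` is an `L`-fixed triple `(G/H, aH, x)`, then `aH` is `L`-fixed. -/
lemma pt_fixed {X : OrbPsh G} {L : Orb G} (y : ((fixedPts G).obj ((elm G).obj X)).obj (op L)) :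
    ∀ l ∈ L.sub, l • Elm.pt ((evalOne ((elm G).obj X) L).obj y)
      = Elm.pt ((evalOne ((elm G).obj X) L).obj y) := by
  intro l hl
  have h := GFun.obj_act (show GFun (discObj L) (elmObj X) from y) l (Discrete.mk L.one)
  have e : (act (discObj L) l).obj (Discrete.mk L.one) = Discrete.mk L.one := by
    refine Discrete.ext ?_
    change ((l * 1 : G) : G ⧸ L.sub) = ((1 : G) : G ⧸ L.sub)
    rw [mul_one, ← QuotientGroup.mk_mul_of_mem (s := L.sub) 1 hl, one_mul]
  rw [e] at h
  have key : ∀ z : Elm X, (Elm.smul X l).obj z = z → l • z.pt = z.pt := by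
    rintro ⟨⟨H, a⟩, x⟩ hz
    have h1 : (op (⟨H, l • a⟩ : PtOrb G)) = op ⟨H, a⟩ := congrArg Grothendieck.base hz
    have h2 := congrArg Opposite.unop h1
    simpa using h2
  exact key _ h

/-- The `L`-fixed triple `(G/H, aH, x)` determined by an object `y` of the presheaf `Φ C X` at
`G/L`. -/
abbrev triple {X : OrbPsh G} {L : Orb G} (y : ((fixedPts G).obj ((elm G).obj X)).obj (op L)) :
    Elm X :=
  (evalOne ((elm G).obj X) L).obj y

/-- The morphism `(f, h)` of `L`-fixed triples determined by a morphism of the presheaf `Φ C X` at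
`G/L`. -/
abbrev tripleHom {X : OrbPsh G} {L : Orb G}
    {y y' : ((fixedPts G).obj ((elm G).obj X)).obj (op L)} (φ : y ⟶ y') : triple y ⟶ triple y' :=
  (evalOne ((elm G).obj X) L).map φ

/-- The map `r_a : G/L → G/H` attached to an `L`-fixed triple `(G/H, aH, x)`. -/
abbrev rMap {X : OrbPsh G} {L : Orb G} (y : ((fixedPts G).obj ((elm G).obj X)).obj (op L)) :
    L ⟶ (triple y).orb :=
  L.fromFixed (triple y).pt (pt_fixed y)

lemma rMap_one {X : OrbPsh G} {L : Orb G}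
    (y : ((fixedPts G).obj ((elm G).obj X)).obj (op L)) :
    Orb.gmap (rMap y) L.one = (triple y).pt :=
  one_smul G _

end Construction

end Elmendorf

open Elmendorf

/-! If the triple (G/H, aH, x) is `L`-fixed, then the coset aH is `L`-fixed, so there is exactly one
`G`-map r_a : G/L → G/H carrying eL to aH, and (r_a, id) is a morphism from the triple to (G/L, eL,
r_a^* x). Thus the fixed category (CX)^L retracts onto the copy of X(G/L) sitting over the pointed
orbit (G/L, eL): the inclusion is η, the retraction is ε, εη = id strictly, and the morphisms (r_a,
id) form a natural transformation id ⇒ ηε. Since ε sends each (r_a, id) to an identity, the induced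
homotopy id ≃ Bη ∘ Bε lies over the identity of BX(G/L).

For `ev` no new homotopy is needed. An object x of ΦA is a `G`-functor on an orbit, and x(aH) =
x(r_a(eL)) = (r_a^* x)(eL), so Φ(ev) = ε on ΦA (`fixedPts_map_evalApp`). Fixed points commute with
`B`, hence B(ev)^L is identified with Bε_L.

Three topological facts carry the argument.

A retraction with a fibrewise homotopy is a weak homotopy equivalence at every base point
(`FiberwiseRetract.isWeakHomotopyEquiv`). The homotopy moves the base point x to g(f x); a collar
along its track moves it back, and `f` is constant on the collar.

A natural transformation induces a homotopy of classifying spaces. The realization of Δ[n] × Δ[1] is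
the topological prism (`prismHomeo`): a point of the former is a weighted strict chain in a product
of two linear orders, and such a chain is recovered from its two marginals. The homotopies on the
simplices then glue to `realHomotopy`.

B(A^L) is the subspace of `L`-fixed points of BA (`fixedSpaceHomeo`). Each point of a realization
has a unique normal form, a nondegenerate simplex with interior coordinates. Hence degreewise
injective maps realize to closed embeddings, and a point is fixed exactly when its nondegenerate
simplex is fixed. -/

namespace Elmendorf

section DeformationRetraction

open unitInterval Topology.Homotopy

/-! ## Deformation retractions are weak homotopy equivalences -/

/-- A continuous map `f` that is a retraction up to a fibrewise homotopy: it has a section `g`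
together with a homotopy from the identity to `g ∘ f` over the target. -/
structure FiberwiseRetract {X Y : Type u} [TopologicalSpace X] [TopologicalSpace Y]
    (f : C(X, Y)) where
  section' : C(Y, X)
  right_inv : ∀ y, f (section' y) = y
  homotopy : C(X × I, X)
  homotopy_zero : ∀ x, homotopy (x, 0) = x
  homotopy_one : ∀ x, homotopy (x, 1) = section' (f x)
  map_homotopy : ∀ x s, f (homotopy (x, s)) = f x

/-! ### Radial coordinates and dilations of the cube -/

namespace CubeScale

variable {n : ℕ}

/-- The distance of a point of the cube from its centre, normalised to be `1` on the boundary. -/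
noncomputable def radius (u : Fin n → I) : ℝ := ‖fun i => 2 * (u i : ℝ) - 1‖

lemma continuous_radius : Continuous (radius : (Fin n → I) → ℝ) := by
  unfold radius
  fun_prop

lemma radius_le_one (u : Fin n → I) : radius u ≤ 1 := by
  refine (pi_norm_le_iff_of_nonneg zero_le_one).2 fun i => ?_
  rw [Real.norm_eq_abs, abs_le]
  constructor <;> linarith [(u i).2.1, (u i).2.2]

lemma radius_nonneg (u : Fin n → I) : 0 ≤ radius u := norm_nonneg _

lemma radius_of_mem_boundary {u : Fin n → I} (hu : u ∈ Cube.boundary (Fin n)) : radius u = 1 := by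
  refine le_antisymm (radius_le_one u) ?_
  obtain ⟨i, hi⟩ := hu
  have h := norm_le_pi_norm (fun i => 2 * (u i : ℝ) - 1) i
  refine le_trans ?_ h
  rcases hi with hi | hi <;> norm_num [hi]

/-- The dilation by `c` of the cube about its centre, truncated to the cube. -/
noncomputable def dilate (c : ℝ) (u : Fin n → I) : Fin n → I :=
  fun i => Set.projIcc 0 1 zero_le_one ((c * (2 * (u i : ℝ) - 1) + 1) / 2)

lemma continuous_dilate : Continuous (fun p : ℝ × (Fin n → I) => dilate p.1 p.2) := by
  unfold dilate
  refine continuous_pi fun i => continuous_projIcc.comp ?_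
  fun_prop

lemma dilate_one (u : Fin n → I) : dilate 1 u = u := by
  funext i
  have h : (1 * (2 * (u i : ℝ) - 1) + 1) / 2 = u i := by ring
  simp [dilate]

lemma exists_radius_eq {u : Fin n → I} (h : 0 < radius u) :
    ∃ i, radius u = |2 * (u i : ℝ) - 1| := by
  by_contra! hne
  have h2 : ∀ i, ‖2 * (u i : ℝ) - 1‖ < radius u := fun i =>
    lt_of_le_of_ne (norm_le_pi_norm (fun i => 2 * (u i : ℝ) - 1) i) (Ne.symm (hne i))
  exact lt_irrefl _ ((pi_norm_lt_iff h).2 h2)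

/-- A coordinate realising the radius is pushed by the dilation to 0 or beyond, or to 1 or beyond,
and the truncation then puts it on a face. -/
lemma dilate_mem_boundary {c : ℝ} {u : Fin n → I} (h : 1 ≤ c * radius u) :
    dilate c u ∈ Cube.boundary (Fin n) := by
  have h0 : 0 < radius u := by
    rcases (radius_nonneg u).eq_or_lt with h' | h'
    · rw [← h', mul_zero] at h
      linarith
    · exact h'
  obtain ⟨i, hi⟩ := exists_radius_eq h0
  refine ⟨i, ?_⟩
  rw [hi] at h
  rcases abs_cases (2 * (u i : ℝ) - 1) with ⟨ha, _⟩ | ⟨ha, _⟩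
  · right
    exact Set.projIcc_of_right_le _ (by rw [ha] at h; linarith)
  · left
    refine Set.projIcc_of_le_left _ ?_
    rw [ha] at h
    linarith

end CubeScale

open CubeScale

section Loops

variable {X : Type u} [TopologicalSpace X] {x : X} {n : ℕ}

/-- A loop shrunk to the concentric cube of half the size. -/
noncomputable def shrink (γ : GenLoop (Fin n) X x) : GenLoop (Fin n) X x :=
  ⟨γ.1.comp ⟨dilate 2, continuous_dilate.comp (continuous_const.prodMk continuous_id)⟩,
    fun u hu => γ.2 _ (dilate_mem_boundary (by
      rw [radius_of_mem_boundary hu]; norm_num))⟩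

/-- The dilation factor runs from 1 to 2; a factor of at least 1 keeps the boundary of the cube in
the boundary, so the homotopy is relative to it. -/
lemma homotopic_shrink (γ : GenLoop (Fin n) X x) : GenLoop.Homotopic γ (shrink γ) := by
  refine ⟨⟨⟨⟨fun p => γ.1 (dilate (1 + (p.1 : ℝ)) p.2), ?_⟩, fun u => ?_, fun u => ?_⟩, ?_⟩⟩
  · exact γ.1.continuous.comp (continuous_dilate.comp
      ((continuous_const.add (continuous_subtype_val.comp continuous_fst)).prodMk continuous_snd))
  · simp [dilate_one]
  · simp only [shrink, Set.Icc.coe_one, ContinuousMap.comp_apply, ContinuousMap.coe_mk]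
    norm_num
  · intro s u hu
    simp only [ContinuousMap.coe_mk]
    rw [γ.2 _ hu]
    refine γ.2 _ (dilate_mem_boundary ?_)
    rw [radius_of_mem_boundary hu]
    linarith [s.2.1]

end Loops

/-! ### Collars and the change of base point -/

namespace FiberwiseRetract

variable {X Y : Type u} [TopologicalSpace X] [TopologicalSpace Y] {f : C(X, Y)}
  (R : FiberwiseRetract f) {n : ℕ}

/-- The track of the homotopy at a point `x`, from `g (f x)` to `x`, along the outer half of the
cube. -/
noncomputable def collar (x : X) (u : Fin n → I) : X :=
  R.homotopy (x, Set.projIcc 0 1 zero_le_one (2 - 2 * radius u))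

lemma continuous_collar (x : X) : Continuous (R.collar x : (Fin n → I) → X) := by
  refine R.homotopy.continuous.comp (continuous_const.prodMk (continuous_projIcc.comp ?_))
  exact continuous_const.sub (continuous_const.mul continuous_radius)

lemma collar_boundary (x : X) {u : Fin n → I} (hu : u ∈ Cube.boundary (Fin n)) :
    R.collar x u = x := by
  rw [collar, Set.projIcc_of_le_left _ (by rw [radius_of_mem_boundary hu]; norm_num)]
  exact R.homotopy_zero x

lemma map_collar (x : X) (u : Fin n → I) : f (R.collar x u) = f x := R.map_homotopy _ _

open Classical in
/-- A family of cubes with boundary `g (f x)` is filled in with a collar to one with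
boundary `x`. -/
lemma continuous_glue {S : Type*} [TopologicalSpace S] (x : X) (Γ : S × (Fin n → I) → X)
    (hΓ : Continuous Γ) (hb : ∀ s, ∀ u ∈ Cube.boundary (Fin n), Γ (s, u) = R.section' (f x)) :
    Continuous (fun p : S × (Fin n → I) =>
      if 2 * radius p.2 ≤ 1 then Γ (p.1, dilate 2 p.2) else R.collar x p.2) := by
  refine Continuous.if_le ?_ ?_ ?_ continuous_const ?_
  · exact hΓ.comp (continuous_fst.prodMk (continuous_dilate.comp
      (continuous_const.prodMk continuous_snd)))
  · exact (R.continuous_collar x).comp continuous_snd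
  · exact continuous_const.mul (continuous_radius.comp continuous_snd)
  -- On the interface `2 * radius = 1` the dilated point lies on the boundary, where `Γ` equals g(f
  -- x), and the collar has reached time 1 of the homotopy, which is also g(f x).
  · intro p hp
    rw [hb _ _ (dilate_mem_boundary hp.ge), collar,
      Set.projIcc_of_right_le _ (by linarith), ← R.homotopy_one]
    rfl

open Classical in
/-- The loop at `x` obtained from a loop at `g (f x)` by adding a collar. -/
noncomputable def conj (x : X) (γ : GenLoop (Fin n) X (R.section' (f x))) :
    GenLoop (Fin n) X x :=
  ⟨⟨fun u => if 2 * radius u ≤ 1 then γ.1 (dilate 2 u) else R.collar x u,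
    (R.continuous_glue (S := Unit) x (fun p => γ.1 p.2) (γ.1.continuous.comp continuous_snd)
      (fun _ u hu => γ.2 u hu)).comp (continuous_const.prodMk continuous_id : Continuous fun u => ((), u))⟩, by
    intro u hu
    have h : ¬ 2 * radius u ≤ 1 := by
      rw [radius_of_mem_boundary hu]
      norm_num
    simpa [h] using R.collar_boundary x hu⟩

open Classical in
lemma conj_apply (x : X) (γ : GenLoop (Fin n) X (R.section' (f x))) (u : Fin n → I) :
    (R.conj x γ).1 u = if 2 * radius u ≤ 1 then γ.1 (dilate 2 u) else R.collar x u := rfl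

/-- A homotopy of loops is glued to the collar in the same way as a single loop, with the time
parameter as the space `S` of `continuous_glue`. -/
lemma conj_homotopic (x : X) {γ γ' : GenLoop (Fin n) X (R.section' (f x))}
    (h : GenLoop.Homotopic γ γ') : GenLoop.Homotopic (R.conj x γ) (R.conj x γ') := by
  classical
  obtain ⟨H⟩ := h
  have hb : ∀ (s : I), ∀ u ∈ Cube.boundary (Fin n), H (s, u) = R.section' (f x) :=
    fun s u hu => (H.eq_fst s hu).trans (γ.2 u hu)
  refine ⟨⟨⟨⟨_, R.continuous_glue x H H.continuous hb⟩, fun u => ?_, fun u => ?_⟩, ?_⟩⟩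
  · simp [conj_apply]
  · simp [conj_apply]
  · intro s u hu
    have h : ¬ 2 * radius u ≤ 1 := by
      rw [radius_of_mem_boundary hu]
      norm_num
    simp [conj_apply, h]

/-- The image of a loop at `x` under `g ∘ f`. -/
noncomputable def push (x : X) (γ : GenLoop (Fin n) X x) :
    GenLoop (Fin n) X (R.section' (f x)) :=
  genLoopMap R.section' n (f x) (genLoopMap f n x γ)

/-- After shrinking, the homotopy of `R` is run on γ for time s · min(1, 2 − 2r), with r the radius.
At s = 1 the inner cube sees the full homotopy, hence g ∘ f ∘ γ; on the outer part the shrunken loop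
is constantly x, so the homotopy traces exactly the collar. On the boundary the running time is 0.
-/
lemma homotopic_conj_push (x : X) (γ : GenLoop (Fin n) X x) :
    GenLoop.Homotopic γ (R.conj x (R.push x γ)) := by
  classical
  refine (homotopic_shrink γ).trans ?_
  refine ⟨⟨⟨⟨fun p => R.homotopy (γ.1 (dilate 2 p.2),
    p.1 * Set.projIcc 0 1 zero_le_one (2 - 2 * radius p.2)), ?_⟩, fun u => ?_, fun u => ?_⟩, ?_⟩⟩
  · refine R.homotopy.continuous.comp (Continuous.prodMk ?_ ?_)
    · exact γ.1.continuous.comp (continuous_dilate.comp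
        (continuous_const.prodMk continuous_snd))
    · exact continuous_fst.mul (continuous_projIcc.comp
        (continuous_const.sub (continuous_const.mul (continuous_radius.comp continuous_snd))))
  · simp only [zero_mul, R.homotopy_zero]
    rfl
  · simp only [one_mul, conj_apply]
    split_ifs with h
    · rw [Set.projIcc_of_right_le _ (by linarith)]
      exact R.homotopy_one _
    · rw [γ.2 _ (dilate_mem_boundary (not_le.1 h).le)]
      rfl
  · intro s u hu
    have hd : γ.1 (dilate 2 u) = x := γ.2 _ (dilate_mem_boundary (by
      rw [radius_of_mem_boundary hu]; norm_num))
    simp only [ContinuousMap.coe_mk]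
    rw [Set.projIcc_of_le_left _ (by rw [radius_of_mem_boundary hu]; norm_num)]
    change R.homotopy (_, s * 0) = γ.1 (dilate 2 u)
    rw [mul_zero, R.homotopy_zero]

/-- This gives surjectivity on homotopy groups. Because the homotopy is fibrewise, `f` collapses the
collar to f x, and on the inner cube f ∘ g = id. -/
lemma genLoopMap_conj (x : X) (β : GenLoop (Fin n) Y (f x)) :
    genLoopMap f n x (R.conj x (genLoopMap R.section' n (f x) β)) = shrink β := by
  classical
  refine GenLoop.ext _ _ fun u => ?_
  change f ((R.conj x (genLoopMap R.section' n (f x) β)).1 u) = β.1 (dilate 2 u)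
  rw [conj_apply]
  split_ifs with h
  · exact R.right_inv _
  · rw [map_collar, β.2 _ (dilate_mem_boundary (not_le.1 h).le)]

include R in
/-- A fibrewise deformation retraction is a weak homotopy equivalence. -/
theorem isWeakHomotopyEquiv : IsWeakHomotopyEquiv f where
  bijective_zerothHomotopy := by
    -- On path components the track of the homotopy suffices: it joins every x to g(f x).
    have track : ∀ x : X, Joined x (R.section' (f x)) := fun x =>
      ⟨⟨⟨fun s => R.homotopy (x, s), by fun_prop⟩, R.homotopy_zero x, R.homotopy_one x⟩⟩
    constructor
    · intro a b
      induction a using Quotient.inductionOn with | h x =>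
      induction b using Quotient.inductionOn with | h x' =>
      intro h
      obtain ⟨p⟩ : Joined (f x) (f x') := Quotient.exact h
      exact Quotient.sound ((track x).trans
        (Joined.trans ⟨p.map R.section'.continuous⟩ (track x').symm))
    · intro b
      induction b using Quotient.inductionOn with | h y =>
      exact ⟨ZerothHomotopy.mk (R.section' y), congrArg ZerothHomotopy.mk (R.right_inv y)⟩
  bijective_homotopyGroup n x _ := by
    constructor
    · intro a b
      induction a using Quotient.inductionOn with | h γ =>
      induction b using Quotient.inductionOn with | h γ' =>
      intro h
      have h' : GenLoop.Homotopic (genLoopMap f n x γ) (genLoopMap f n x γ') := Quotient.exact h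
      have h'' : GenLoop.Homotopic (R.push x γ) (R.push x γ') :=
        h'.map fun F => F.compContinuousMap R.section'
      exact Quotient.sound ((R.homotopic_conj_push x γ).trans
        ((R.conj_homotopic x h'').trans (R.homotopic_conj_push x γ').symm))
    · intro b
      induction b using Quotient.inductionOn with | h β =>
      refine ⟨Quotient.mk _ (R.conj x (genLoopMap R.section' n (f x) β)), ?_⟩
      change Quotient.mk _ (genLoopMap f n x _) = _
      rw [genLoopMap_conj]
      exact Quotient.sound (homotopic_shrink β).symm

/-- Fibrewise deformation retractions are invariant under homeomorphism. -/
def congr {X' Y' : Type u} [TopologicalSpace X'] [TopologicalSpace Y'] {f' : C(X', Y')}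
    (a : X ≃ₜ X') (b : Y ≃ₜ Y') (h : ∀ x, b (f x) = f' (a x)) : FiberwiseRetract f' where
  section' := ⟨fun y => a (R.section' (b.symm y)), by fun_prop⟩
  right_inv y := by simp [← h, R.right_inv]
  homotopy := ⟨fun p => a (R.homotopy (a.symm p.1, p.2)), by fun_prop⟩
  homotopy_zero x := by simp [R.homotopy_zero]
  homotopy_one x := by
    have h' : f (a.symm x) = b.symm (f' x) := by
      rw [Homeomorph.eq_symm_apply, h, a.apply_symm_apply]
    simp [R.homotopy_one, h']
  map_homotopy x s := by simp [← h, R.map_homotopy]; simp [h]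

end FiberwiseRetract

end DeformationRetraction

end Elmendorf

namespace Elmendorf

section Realization

open Simplicial

/-! ## Points of geometric realizations -/

/-- The topological standard simplex attached to an object of the simplex category. -/
abbrev TopSimplex (n : SimplexCategory) : Type := stdSimplex ℝ (Fin (n.len + 1))

/-- The map of topological simplices induced by a morphism of the simplex category. -/
noncomputable def TopSimplex.map {n m : SimplexCategory} (f : n ⟶ m) (t : TopSimplex n) :
    TopSimplex m :=
  stdSimplex.map f t

lemma TopSimplex.map_comp {n m k : SimplexCategory} (f : n ⟶ m) (g : m ⟶ k) (t : TopSimplex n) :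
    TopSimplex.map (f ≫ g) t = TopSimplex.map g (TopSimplex.map f t) :=
  (stdSimplex.map_comp_apply (f := f) (g := g) t).symm

lemma TopSimplex.map_id (n : SimplexCategory) (t : TopSimplex n) :
    TopSimplex.map (𝟙 n) t = t :=
  stdSimplex.map_id_apply t

lemma TopSimplex.continuous_map {n m : SimplexCategory} (f : n ⟶ m) :
    Continuous (TopSimplex.map f) :=
  stdSimplex.continuous_map f

lemma TopSimplex.map_apply {n m : SimplexCategory} (f : n ⟶ m) (t : TopSimplex n)
    (j : Fin (m.len + 1)) :
    TopSimplex.map f t j = ∑ i, if f i = j then t i else 0 := by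
  change (stdSimplex.map f t : Fin (m.len + 1) → ℝ) j = _
  rw [stdSimplex.map_coe, FunOnFinite.linearMap_apply_apply, Finset.sum_filter]

variable {X Y : SSet.{u}}

/-- The point of the geometric realization with barycentric coordinates `t` in a simplex. -/
noncomputable def realPt {n : SimplexCategory} (σ : X.obj (op n)) (t : TopSimplex n) :
    SSet.toTop.obj X :=
  SSet.toTop.map (SSet.yonedaEquiv.symm σ) (n.toTopHomeo.symm t)

lemma continuous_realPt {n : SimplexCategory} (σ : X.obj (op n)) : Continuous (realPt σ) :=
  (SSet.toTop.map (SSet.yonedaEquiv.symm σ)).hom.continuous.comp n.toTopHomeo.symm.continuous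

lemma realPt_map {n m : SimplexCategory} (f : m ⟶ n) (σ : X.obj (op n)) (t : TopSimplex m) :
    realPt (X.map f.op σ) t = realPt σ (TopSimplex.map f t) := by
  unfold realPt TopSimplex.map
  rw [SimplexCategory.toTopHomeo_symm_naturality_apply, ← SSet.yonedaEquiv_symm_naturality_left,
    Functor.map_comp]
  rfl

lemma map_realPt (φ : X ⟶ Y) {n : SimplexCategory} (σ : X.obj (op n)) (t : TopSimplex n) :
    SSet.toTop.map φ (realPt σ t) = realPt (φ.app (op n) σ) t := by
  unfold realPt
  rw [← SSet.yonedaEquiv_symm_comp, Functor.map_comp]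
  rfl

/-- A compatible family of continuous maps out of the simplices of a simplicial set. -/
structure RealCocone (X : SSet.{u}) (Z : Type u) [TopologicalSpace Z] where
  map {n : SimplexCategory} (σ : X.obj (op n)) : C(TopSimplex n, Z)
  compat {n m : SimplexCategory} (f : m ⟶ n) (σ : X.obj (op n)) (t : TopSimplex m) :
    map (X.map f.op σ) t = map σ (TopSimplex.map f t)

namespace RealCocone

variable {Z : Type u} [TopologicalSpace Z] (c : RealCocone X Z)

/-- The map to the singular simplicial set adjoint to a compatible family. -/
noncomputable def toSing : X ⟶ TopCat.toSSet.obj (TopCat.of Z) where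
  app n := ↾fun σ => ((TopCat.of Z).toSSetObjEquiv n).symm (c.map σ)
  naturality n m f := by
    ext σ
    change ((TopCat.of Z).toSSetObjEquiv m).symm (c.map (X.map f.unop.op σ)) =
      (TopCat.toSSet.obj (TopCat.of Z)).map f.unop.op (((TopCat.of Z).toSSetObjEquiv n).symm (c.map σ))
    rw [TopCat.toSSetObjEquiv_symm_naturality]
    congr 1
    ext t
    exact c.compat f.unop σ t

/-- The continuous map out of the realization induced by a compatible family. -/
noncomputable def desc : C(SSet.toTop.obj X, Z) :=
  ((sSetTopAdj.homEquiv X (TopCat.of Z)).symm c.toSing).hom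

lemma desc_realPt {n : SimplexCategory} (σ : X.obj (op n)) (t : TopSimplex n) :
    c.desc (realPt σ t) = c.map σ t := by
  have h := congrArg (fun k => ((TopCat.of Z).toSSetObjEquiv (op n)) (k.app (op n) σ) t)
    ((sSetTopAdj.homEquiv X (TopCat.of Z)).apply_symm_apply c.toSing)
  simp only [Adjunction.homEquiv_unit] at h
  have h2 : ((TopCat.of Z).toSSetObjEquiv (op n)) (c.toSing.app (op n) σ) t = c.map σ t := rfl
  rw [← h2, ← h]
  have h3 := sSetTopAdj_unit_app_app_down X (op n) σ
  change _ = ((sSetTopAdj.homEquiv X (TopCat.of Z)).symm c.toSing).hom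
    (((sSetTopAdj.unit.app X).app (op n) σ).down.hom (ULift.up t))
  rw [h3]
  rfl

end RealCocone

lemma real_hom_ext {Z : TopCat.{u}} {f g : SSet.toTop.obj X ⟶ Z}
    (h : ∀ (n : SimplexCategory) (σ : X.obj (op n)) (t : TopSimplex n),
      f (realPt σ t) = g (realPt σ t)) : f = g := by
  apply (sSetTopAdj.homEquiv X Z).injective
  ext n σ
  apply (Z.toSSetObjEquiv n).injective
  ext t
  have key : ∀ k : SSet.toTop.obj X ⟶ Z,
      (Z.toSSetObjEquiv n) ((sSetTopAdj.homEquiv X Z k).app n σ) t = k (realPt σ t) := by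
    intro k
    rw [Adjunction.homEquiv_unit]
    change k.hom (((sSetTopAdj.unit.app X).app n σ).down.hom (ULift.up t)) = _
    rw [sSetTopAdj_unit_app_app_down X n σ]
    rfl
  exact (key f).trans ((h _ σ t).trans (key g).symm)

/-- A type endowed with the indiscrete topology. -/
def Indiscrete (α : Type u) : Type u := α

instance (α : Type u) : TopologicalSpace (Indiscrete α) := ⊤

/-- A map out of the realization is determined by its values on simplices. Into an indiscrete space
every function is continuous, so the predicate of lying in some simplex and the constant `True` are
two maps agreeing on all simplices, hence equal. -/
lemma exists_realPt (p : SSet.toTop.obj X) :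
    ∃ (n : SimplexCategory) (σ : X.obj (op n)) (t : TopSimplex n), realPt σ t = p := by
  let S : SSet.toTop.obj X → Prop := fun p => ∃ (n : SimplexCategory) (σ : X.obj (op n))
    (t : TopSimplex n), realPt σ t = p
  let f : SSet.toTop.obj X ⟶ TopCat.of (Indiscrete (ULift.{u} Prop)) :=
    TopCat.ofHom ⟨fun p => ULift.up (S p), continuous_top⟩
  let g : SSet.toTop.obj X ⟶ TopCat.of (Indiscrete (ULift.{u} Prop)) :=
    TopCat.ofHom ⟨fun _ => ULift.up True, continuous_top⟩
  have h : f = g := real_hom_ext fun n σ t =>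
    congrArg ULift.up (eq_true (⟨n, σ, t, rfl⟩ : S (realPt σ t)))
  have h' : ULift.up (S p) = ULift.up True := congrArg (fun k => k.hom p) h
  exact of_eq_true (congrArg ULift.down h')

/-- Open sets are the continuous maps to the Sierpiński space `Prop`, and a compatible family of
such maps on the simplices descends to the realization. -/
lemma isOpen_of_realPt {U : Set (SSet.toTop.obj X)}
    (hU : ∀ (n : SimplexCategory) (σ : X.obj (op n)), IsOpen (realPt σ ⁻¹' U)) : IsOpen U := by
  let c : RealCocone X (ULift.{u} Prop) :=
    { map := fun σ => ⟨fun t => ULift.up (realPt σ t ∈ U),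
        continuous_uliftUp.comp (continuous_Prop.2 (hU _ σ))⟩
      compat := fun f σ t => by simp [realPt_map] }
  have h : ∀ p, (c.desc p).down = (p ∈ U) := by
    intro p
    obtain ⟨n, σ, t, rfl⟩ := exists_realPt p
    exact congrArg ULift.down (c.desc_realPt σ t)
  have h' : Continuous fun p => (c.desc p).down :=
    continuous_uliftDown.comp c.desc.continuous
  simp only [h] at h'
  exact continuous_Prop.1 h'

lemma isClosed_of_realPt {U : Set (SSet.toTop.obj X)}
    (hU : ∀ (n : SimplexCategory) (σ : X.obj (op n)), IsClosed (realPt σ ⁻¹' U)) :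
    IsClosed U :=
  isOpen_compl_iff.1 (isOpen_of_realPt fun n σ => (hU n σ).isOpen_compl)

/-! ## Normal forms of points -/

/-- The interior of a topological simplex. -/
def TopSimplex.Interior {n : SimplexCategory} (t : TopSimplex n) : Prop := ∀ i, 0 < t i

lemma TopSimplex.map_pos_iff {n m : SimplexCategory} (f : n ⟶ m) (t : TopSimplex n)
    (j : Fin (m.len + 1)) : 0 < TopSimplex.map f t j ↔ ∃ i, f i = j ∧ 0 < t i := by
  rw [map_apply]
  constructor
  · intro h
    obtain ⟨i, _, hi⟩ := Finset.exists_lt_of_sum_lt (s := Finset.univ) (f := fun _ => (0 : ℝ))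
      (by simpa using h)
    by_cases hf : f i = j
    · exact ⟨i, hf, by simpa [hf] using hi⟩
    · simp [hf] at hi
  · rintro ⟨i, hf, hi⟩
    refine Finset.sum_pos' (fun k _ => ?_) ⟨i, Finset.mem_univ _, by simpa [hf] using hi⟩
    split_ifs
    · exact stdSimplex.zero_le t k
    · exact le_rfl

lemma TopSimplex.map_mono_apply {n m : SimplexCategory} (f : n ⟶ m) (hf : Function.Injective f)
    (t : TopSimplex n) (i : Fin (n.len + 1)) : TopSimplex.map f t (f i) = t i := by
  rw [map_apply, Finset.sum_eq_single i]
  · simp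
  · intro j _ hj
    simp [hf.ne hj]
  · simp

lemma TopSimplex.map_injective {n m : SimplexCategory} (f : n ⟶ m) (hf : Function.Injective f) :
    Function.Injective (TopSimplex.map f) := by
  intro t t' h
  refine stdSimplex.ext (funext fun i => ?_)
  change t i = t' i
  rw [← map_mono_apply f hf t, h, map_mono_apply f hf]

/-- A point of a simplex is interior to a unique face. -/
lemma TopSimplex.exists_face {n : SimplexCategory} (t : TopSimplex n) :
    ∃ (k : ℕ) (δ : ⦋k⦌ ⟶ n) (t₀ : TopSimplex ⦋k⦌), Function.Injective δ ∧ t₀.Interior ∧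
      TopSimplex.map δ t₀ = t := by
  classical
  let S : Finset (Fin (n.len + 1)) := Finset.univ.filter fun i => 0 < t i
  have hS : S.Nonempty := by
    by_contra hS
    have h0 : ∀ i, t i = 0 := fun i => by
      refine le_antisymm (not_lt.1 fun hi => hS ⟨i, ?_⟩) (stdSimplex.zero_le t i)
      simpa [S] using hi
    have := stdSimplex.sum_eq_one t
    simp [h0] at this
  obtain ⟨k, hk⟩ : ∃ k, S.card = k + 1 := ⟨S.card - 1, by have := hS.card_pos; omega⟩
  let e := S.orderEmbOfFin hk
  let δ : ⦋k⦌ ⟶ n := SimplexCategory.Hom.mk e.toOrderHom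
  have hδ : ∀ i, δ i = e i := fun _ => rfl
  have hsum : ∑ i, t (e i) = 1 := by
    rw [← stdSimplex.sum_eq_one t, ← Finset.sum_filter_of_ne (p := fun i => 0 < t i)
      (fun i _ hi => lt_of_le_of_ne (stdSimplex.zero_le t i) hi.symm)]
    change _ = ∑ i ∈ S, t i
    rw [← Finset.map_orderEmbOfFin_univ S hk, Finset.sum_map]
    rfl
  have hpos : ∀ i, 0 < t (e i) := fun i => by
    have := S.orderEmbOfFin_mem hk i
    exact (Finset.mem_filter.1 this).2
  let t₀ : TopSimplex ⦋k⦌ := ⟨fun i => t (e i), fun i => (hpos i).le, hsum⟩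
  refine ⟨k, δ, t₀, e.injective, hpos, stdSimplex.ext (funext fun j => ?_)⟩
  change TopSimplex.map δ t₀ j = t j
  by_cases hj : 0 < t j
  · have : j ∈ Set.range e := by
      rw [Finset.range_orderEmbOfFin]
      simpa [S] using hj
    obtain ⟨i, rfl⟩ := this
    exact map_mono_apply δ e.injective t₀ i
  · have h1 : ¬ 0 < TopSimplex.map δ t₀ j := by
      rw [map_pos_iff]
      rintro ⟨i, rfl, _⟩
      exact hj (hpos i)
    exact le_antisymm ((not_lt.1 h1).trans (stdSimplex.zero_le t j))
      ((not_lt.1 hj).trans (stdSimplex.zero_le _ j))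

/-- A morphism carrying some interior point to an interior point is surjective. -/
lemma TopSimplex.surjective_of_map {n m : SimplexCategory} (f : n ⟶ m) (t : TopSimplex n)
    (h : (TopSimplex.map f t).Interior) : Function.Surjective f := fun j =>
  let ⟨i, hi, _⟩ := (map_pos_iff f t j).1 (h j)
  ⟨i, hi⟩

/-- If `t = δ₀ t₀` with `δ₀` injective, then any `δ` carrying an interior point to `t` factors
through `δ₀`. -/
lemma TopSimplex.exists_factor {n m k : SimplexCategory} (δ₀ : k ⟶ n)
    (h₀ : Function.Injective δ₀) (t₀ : TopSimplex k) (δ : m ⟶ n) (s : TopSimplex m)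
    (hs : s.Interior) (h : TopSimplex.map δ s = TopSimplex.map δ₀ t₀) :
    ∃ a : m ⟶ k, a ≫ δ₀ = δ ∧ TopSimplex.map a s = t₀ := by
  have hex : ∀ i, ∃ j, δ₀ j = δ i := fun i => by
    have : 0 < TopSimplex.map δ s (δ i) := (map_pos_iff _ _ _).2 ⟨i, rfl, hs i⟩
    rw [h] at this
    obtain ⟨j, hj, _⟩ := (map_pos_iff _ _ _).1 this
    exact ⟨j, hj⟩
  choose a ha using hex
  have hmono : Monotone a := fun i i' hi => by
    have hsm : StrictMono δ₀ := δ₀.toOrderHom.monotone.strictMono_of_injective h₀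
    refine hsm.le_iff_le.1 ?_
    rw [ha, ha]
    exact δ.toOrderHom.monotone hi
  let a' : m ⟶ k := SimplexCategory.Hom.mk ⟨a, hmono⟩
  have ha' : a' ≫ δ₀ = δ := by
    ext i : 3
    exact ha i
  refine ⟨a', ha', map_injective δ₀ h₀ ?_⟩
  rw [← map_comp, ha', h]

variable (X) in
/-- Normal forms of points of the realization: a nondegenerate simplex and a point of the
topological simplex of the same dimension. -/
def NormalForm : Type u := Σ m : ℕ, X.nonDegenerate m × TopSimplex ⦋m⦌

/-- The relation between a point of a simplex and a normal form. -/
def IsNormalForm {n : SimplexCategory} (σ : X.obj (op n)) (t : TopSimplex n)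
    (N : NormalForm X) : Prop :=
  ∃ (k : ℕ) (δ : ⦋k⦌ ⟶ n) (u : TopSimplex ⦋k⦌) (e : ⦋k⦌ ⟶ ⦋N.1⦌), u.Interior ∧
    TopSimplex.map δ u = t ∧ Function.Surjective e ∧ X.map δ.op σ = X.map e.op N.2.1.1 ∧
    TopSimplex.map e u = N.2.2

lemma exists_isNormalForm {n : SimplexCategory} (σ : X.obj (op n)) (t : TopSimplex n) :
    ∃ N, IsNormalForm σ t N := by
  obtain ⟨k, δ, u, _, hu, h⟩ := t.exists_face
  obtain ⟨m, e, he, y, hy⟩ := X.exists_nonDegenerate (X.map δ.op σ)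
  exact ⟨⟨m, y, TopSimplex.map e u⟩, k, δ, u, e, hu, h,
    SimplexCategory.epi_iff_surjective.1 he, hy, rfl⟩

/-- `IsNormalForm` allows a non-injective δ, which makes it compatible with simplicial operators
(`IsNormalForm.map`). Uniqueness survives: every admissible δ factors through the injective face of
t by a surjection, and the Eilenberg–Zilber uniqueness of the nondegenerate simplex and of its
degeneracy operator applies. -/
lemma IsNormalForm.unique {n : SimplexCategory} {σ : X.obj (op n)} {t : TopSimplex n}
    {N N' : NormalForm X} (h : IsNormalForm σ t N) (h' : IsNormalForm σ t N') : N = N' := by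
  obtain ⟨k₀, δ₀, t₀, hδ₀, ht₀, rfl⟩ := t.exists_face
  obtain ⟨m₀, p, hp, ρ, hρ⟩ := X.exists_nonDegenerate (X.map δ₀.op σ)
  suffices H : ∀ N : NormalForm X, IsNormalForm σ (TopSimplex.map δ₀ t₀) N →
      N = ⟨m₀, ρ, TopSimplex.map p t₀⟩ from (H N h).trans (H N' h').symm
  rintro ⟨m, τ, s⟩ ⟨k, δ, v, e, hv, hδ, he, hτ, hs⟩
  dsimp only at e he hτ hs
  obtain ⟨a, rfl, rfl⟩ := TopSimplex.exists_factor δ₀ hδ₀ t₀ δ v hv hδ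
  have hae : Function.Surjective a := TopSimplex.surjective_of_map a v ht₀
  have : Epi a := SimplexCategory.epi_iff_surjective.2 hae
  have : Epi e := SimplexCategory.epi_iff_surjective.2 he
  have h1 : X.map (a ≫ δ₀).op σ = X.map (a ≫ p).op ρ := by
    rw [op_comp, op_comp, Functor.map_comp_apply, Functor.map_comp_apply, hρ]
  obtain rfl : m = m₀ := X.unique_nonDegenerate_dim _ e τ hτ (a ≫ p) ρ h1
  obtain rfl : τ = ρ := X.unique_nonDegenerate_simplex _ e τ hτ (a ≫ p) ρ h1
  obtain rfl : e = a ≫ p := X.unique_nonDegenerate_map _ e τ hτ (a ≫ p) τ h1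
  rw [← hs, TopSimplex.map_comp]

/-- The normal form of a point of a simplex. -/
noncomputable def normalForm {n : SimplexCategory} (σ : X.obj (op n)) (t : TopSimplex n) :
    NormalForm X :=
  (exists_isNormalForm σ t).choose

lemma isNormalForm_normalForm {n : SimplexCategory} (σ : X.obj (op n)) (t : TopSimplex n) :
    IsNormalForm σ t (normalForm σ t) :=
  (exists_isNormalForm σ t).choose_spec

lemma IsNormalForm.map {n m : SimplexCategory} (f : m ⟶ n) {σ : X.obj (op n)} {t : TopSimplex m}
    {N : NormalForm X} (h : IsNormalForm (X.map f.op σ) t N) :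
    IsNormalForm σ (TopSimplex.map f t) N := by
  obtain ⟨k, δ, u, e, hu, rfl, he, hτ, hs⟩ := h
  refine ⟨k, δ ≫ f, u, e, hu, TopSimplex.map_comp _ _ _, he, ?_, hs⟩
  rw [← hτ, op_comp, Functor.map_comp_apply]

lemma isNormalForm_self {m : ℕ} (σ : X.nonDegenerate m) (t : TopSimplex ⦋m⦌) (ht : t.Interior) :
    IsNormalForm σ.1 t ⟨m, σ, t⟩ :=
  ⟨m, 𝟙 _, t, 𝟙 _, ht, TopSimplex.map_id _ _, Function.surjective_id, rfl,
    TopSimplex.map_id _ _⟩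

lemma IsNormalForm.realPt_eq {n : SimplexCategory} {σ : X.obj (op n)} {t : TopSimplex n}
    {N : NormalForm X} (h : IsNormalForm σ t N) : realPt σ t = realPt N.2.1.1 N.2.2 := by
  obtain ⟨k, δ, u, e, hu, rfl, he, hτ, hs⟩ := h
  rw [← hs, ← realPt_map, ← realPt_map, hτ]

lemma IsNormalForm.interior {n : SimplexCategory} {σ : X.obj (op n)} {t : TopSimplex n}
    {N : NormalForm X} (h : IsNormalForm σ t N) : N.2.2.Interior := by
  obtain ⟨k, δ, u, e, hu, rfl, he, hτ, hs⟩ := h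
  intro j
  obtain ⟨i, hi⟩ := he j
  rw [← hs]
  exact (TopSimplex.map_pos_iff _ _ _).2 ⟨i, hi, hu i⟩

variable (X) in
/-- The compatible family of normal forms. -/
noncomputable def normalFormCocone : RealCocone X (Indiscrete (NormalForm X)) where
  map σ := ⟨fun t => normalForm σ t, continuous_top⟩
  compat f σ t := ((isNormalForm_normalForm (X.map f.op σ) t).map f).unique
    (isNormalForm_normalForm σ (TopSimplex.map f t))

/-- The normal form of a point of the realization. -/
noncomputable def ptForm (p : SSet.toTop.obj X) : NormalForm X := (normalFormCocone X).desc p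

lemma ptForm_realPt {n : SimplexCategory} {σ : X.obj (op n)} {t : TopSimplex n}
    {N : NormalForm X} (h : IsNormalForm σ t N) : ptForm (realPt σ t) = N :=
  ((normalFormCocone X).desc_realPt σ t).trans ((isNormalForm_normalForm σ t).unique h)

lemma exists_normal (p : SSet.toTop.obj X) :
    ∃ (m : ℕ) (σ : X.nonDegenerate m) (t : TopSimplex ⦋m⦌), t.Interior ∧ realPt σ.1 t = p := by
  obtain ⟨n, σ, t, rfl⟩ := exists_realPt p
  have h := isNormalForm_normalForm σ t
  exact ⟨_, _, _, h.interior, h.realPt_eq.symm⟩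

end Realization
end Elmendorf

namespace Elmendorf

section Subcomplexes

open Simplicial

/-! ## Realizations of monomorphisms and fixed points -/

variable {X Y : SSet.{u}} (i : Y ⟶ X)

/-- A map of simplicial sets that is injective in every degree. -/
def LevelwiseInjective : Prop := ∀ n : SimplexCategory, Function.Injective (i.app (op n))

variable {i}

lemma LevelwiseInjective.nonDegenerate (hi : LevelwiseInjective i) {m : ℕ}
    (σ : Y.nonDegenerate m) : i.app (op ⦋m⦌) σ.1 ∈ X.nonDegenerate m := by
  have : Mono i := by
    have : ∀ n, Mono (i.app n) := fun n => (mono_iff_injective _).2 (hi n.unop)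
    exact NatTrans.mono_of_mono_app i
  exact (SSet.nonDegenerate_iff_of_mono i σ.1).2 σ.2

lemma LevelwiseInjective.ptForm_map (hi : LevelwiseInjective i) {m : ℕ} (σ : Y.nonDegenerate m)
    {t : TopSimplex ⦋m⦌} (ht : t.Interior) :
    ptForm (SSet.toTop.map i (realPt σ.1 t))
      = ⟨m, ⟨i.app (op ⦋m⦌) σ.1, hi.nonDegenerate σ⟩, t⟩ := by
  rw [map_realPt]
  exact ptForm_realPt (isNormalForm_self ⟨_, hi.nonDegenerate σ⟩ t ht)

/-- A degreewise injective map preserves nondegenerate simplices, so it acts on normal forms by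
changing the simplex and keeping the coordinates. -/
lemma LevelwiseInjective.injective_map (hi : LevelwiseInjective i) :
    Function.Injective (SSet.toTop.map i) := by
  intro p q h
  obtain ⟨m, σ, t, ht, rfl⟩ := exists_normal p
  obtain ⟨m', σ', t', ht', rfl⟩ := exists_normal q
  have h' := congrArg ptForm h
  rw [hi.ptForm_map σ ht, hi.ptForm_map σ' ht'] at h'
  obtain rfl : m = m' := congrArg Sigma.fst h'
  have h2 := eq_of_heq (Sigma.mk.inj h').2
  have h3 : σ.1 = σ'.1 := hi _ (congrArg (fun z => z.1.1) h2)
  rw [h3, show t = t' from congrArg Prod.snd h2]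

/-- Closedness is tested on each simplex of `X`. There the preimage of the image of `C` is a union
over the operators δ for which δ^*σ comes from `Y`, and only those of dimension at most that of σ
are needed, so there are finitely many. Each contributes the image of a compact set. -/
lemma LevelwiseInjective.isClosedMap (hi : LevelwiseInjective i) :
    IsClosedMap (SSet.toTop.map i) := by
  intro C hC
  refine isClosed_of_realPt fun n σ => ?_
  have key : realPt σ ⁻¹' (SSet.toTop.map i '' C) =
      ⋃ (k : Fin (n.len + 1)) (δ : {δ : ⦋(k : ℕ)⦌ ⟶ n //
        ∃ y, i.app (op ⦋(k : ℕ)⦌) y = X.map δ.op σ}),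
        TopSimplex.map δ.1 '' (realPt δ.2.choose ⁻¹' C) := by
    ext t
    simp only [Set.mem_preimage, Set.mem_iUnion, Set.mem_image]
    constructor
    · rintro ⟨c, hc, hct⟩
      obtain ⟨m, τ, s, hs, rfl⟩ := exists_normal c
      obtain ⟨k, δ, u, hδ, hu, rfl⟩ := t.exists_face
      obtain ⟨k', p, hp, ρ, hρ⟩ := X.exists_nonDegenerate (X.map δ.op σ)
      have h1 : IsNormalForm σ (TopSimplex.map δ u) ⟨k', ρ, TopSimplex.map p u⟩ :=
        ⟨k, δ, u, p, hu, rfl, SimplexCategory.epi_iff_surjective.1 hp, hρ, rfl⟩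
      have h2 := ptForm_realPt h1
      rw [← hct, hi.ptForm_map τ hs] at h2
      obtain rfl : m = k' := congrArg Sigma.fst h2
      have h3 := eq_of_heq (Sigma.mk.inj h2).2
      have h4 : i.app _ τ.1 = ρ.1 := congrArg (fun z => z.1.1) h3
      have h5 : s = TopSimplex.map p u := congrArg Prod.snd h3
      -- Comparing normal forms shows that the nondegenerate simplex underlying the face comes from
      -- `Y`; hence so does its degeneracy, the face itself.
      have h6 : i.app (op ⦋k⦌) (Y.map p.op τ.1) = X.map δ.op σ := by
        rw [hρ, ← h4, NatTrans.naturality_apply]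
      have hk : k < n.len + 1 := by
        have := Fintype.card_le_of_injective δ hδ
        simp at this
        omega
      have hex : ∃ y, i.app (op ⦋k⦌) y = X.map δ.op σ := ⟨_, h6⟩
      refine ⟨⟨k, hk⟩, ⟨δ, hex⟩, u, ?_, rfl⟩
      have h7 : hex.choose = Y.map p.op τ.1 := hi _ (hex.choose_spec.trans h6.symm)
      change realPt hex.choose u ∈ C
      rw [h7, realPt_map, ← h5]
      exact hc
    · rintro ⟨k, δ, u, hu, rfl⟩
      refine ⟨_, hu, ?_⟩
      rw [map_realPt, δ.2.choose_spec, realPt_map]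
  rw [key]
  have hfin : ∀ k : ℕ, Finite (⦋k⦌ ⟶ n) := fun k =>
    Finite.of_injective (fun f => (f.toOrderHom : Fin (k + 1) → Fin (n.len + 1)))
      fun f g h => by ext i : 3; exact congrFun h i
  refine isClosed_iUnion_of_finite fun k => isClosed_iUnion_of_finite fun δ => ?_
  exact ((hC.preimage (continuous_realPt _)).isCompact.image
    (TopSimplex.continuous_map δ.1)).isClosed

lemma LevelwiseInjective.isClosedEmbedding (hi : LevelwiseInjective i) :
    Topology.IsClosedEmbedding (SSet.toTop.map i) :=
  .of_continuous_injective_isClosedMap (SSet.toTop.map i).hom.continuous hi.injective_map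
    hi.isClosedMap

/-- If the simplices of `Y` are the simplices of `X` fixed by a family of injective self-maps, then
the points of `|Y|` are the points of `|X|` fixed by this family. -/
lemma mem_range_toTop_map_iff {J : Type*} (φ : J → (X ⟶ X))
    (hφ : ∀ j, LevelwiseInjective (φ j))
    (hfix : ∀ (n : SimplexCategory) (σ : X.obj (op n)),
      (∃ y, i.app (op n) y = σ) ↔ ∀ j, (φ j).app (op n) σ = σ) (p : SSet.toTop.obj X) :
    (∃ q, SSet.toTop.map i q = p) ↔ ∀ j, SSet.toTop.map (φ j) p = p := by
  constructor
  · rintro ⟨q, rfl⟩ j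
    obtain ⟨n, y, t, rfl⟩ := exists_realPt q
    rw [map_realPt, map_realPt, (hfix n _).1 ⟨y, rfl⟩ j]
  · intro h
    obtain ⟨m, σ, t, ht, rfl⟩ := exists_normal p
    -- Each `φ j` acts on a normal form only through its simplex, so fixing the point forces it to
    -- fix σ.
    obtain ⟨y, hy⟩ := (hfix _ σ.1).2 fun j => by
      have h' := congrArg ptForm (h j)
      rw [(hφ j).ptForm_map σ ht, ptForm_realPt (isNormalForm_self σ t ht)] at h'
      exact congrArg (fun z => z.1.1) (eq_of_heq (Sigma.mk.inj h').2)
    exact ⟨realPt y t, by rw [map_realPt, hy]⟩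

end Subcomplexes

end Elmendorf

namespace Elmendorf

section Prism

open Simplicial MonoidalCategory CartesianMonoidalCategory

/-! ## The realization of a prism -/

/-- Möbius inversion on a finite poset: weights are recovered from their cumulative sums by
induction from below. -/
lemma eq_of_sum_Iic_eq {P : Type*} [PartialOrder P] [Fintype P] [DecidableLE P]
    {w w' : P → ℝ} (h : ∀ p, ∑ x with x ≤ p, w x = ∑ x with x ≤ p, w' x) : w = w' := by
  classical
  funext p
  induction p using WellFoundedLT.induction with
  | ind p ih =>
  have key : ∀ v : P → ℝ, ∑ x with x ≤ p, v x = v p + ∑ x with x < p, v x := by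
    intro v
    rw [← Finset.sum_insert (by simp)]
    congr 1
    ext x
    simp [le_iff_eq_or_lt]
  have h1 := h p
  rw [key, key, Finset.sum_congr rfl fun x hx => ih x (by simpa using hx)] at h1
  exact add_right_cancel h1

/-! ### Weights on chains and their marginals -/

section Coupling

variable {P Q : Type*} [LinearOrder P] [LinearOrder Q]

/-- The total weight of a family of weights at a point. -/
def weightAt {R : Type*} [DecidableEq R] {m : ℕ} (f : Fin (m + 1) → R) (t : Fin (m + 1) → ℝ)
    (r : R) : ℝ := ∑ l, if f l = r then t l else 0

lemma sum_weightAt {R : Type*} [DecidableEq R] [Fintype R] {m : ℕ} (f : Fin (m + 1) → R)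
    (t : Fin (m + 1) → ℝ) (p : R → Prop) [DecidablePred p] :
    ∑ r with p r, weightAt f t r = ∑ l, if p (f l) then t l else 0 := by
  unfold weightAt
  rw [Finset.sum_comm]
  refine Finset.sum_congr rfl fun l _ => ?_
  rw [Finset.sum_ite_eq]
  simp

/-- Weights on a chain of a product of linear orders have the comonotone joint distribution. -/
lemma sum_chain_eq_min {m : ℕ} (f : Fin (m + 1) → P × Q) (hf : Monotone f)
    {t : Fin (m + 1) → ℝ} (ht : ∀ l, 0 ≤ t l) (p : P × Q) :
    (∑ l, if f l ≤ p then t l else 0) =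
      min (∑ l, if (f l).1 ≤ p.1 then t l else 0) (∑ l, if (f l).2 ≤ p.2 then t l else 0) := by
  have h1 : (∑ l, if f l ≤ p then t l else 0) ≤ ∑ l, if (f l).1 ≤ p.1 then t l else 0 := by
    refine Finset.sum_le_sum fun l _ => ?_
    split_ifs with h h' h'
    · exact le_rfl
    · exact absurd h.1 h'
    · exact ht l
    · exact le_rfl
  have h2 : (∑ l, if f l ≤ p then t l else 0) ≤ ∑ l, if (f l).2 ≤ p.2 then t l else 0 := by
    refine Finset.sum_le_sum fun l _ => ?_
    split_ifs with h h' h'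
    · exact le_rfl
    · exact absurd h.2 h'
    · exact ht l
    · exact le_rfl
  -- Along a chain both conditions cut out initial segments, and two initial segments are nested;
  -- the smaller one is the set where `f l ≤ p`.
  have h3 : (∀ l, (f l).1 ≤ p.1 → (f l).2 ≤ p.2) ∨ (∀ l, (f l).2 ≤ p.2 → (f l).1 ≤ p.1) := by
    by_contra! h
    obtain ⟨⟨l, hl, hl'⟩, ⟨k, hk, hk'⟩⟩ := h
    rcases le_total l k with hlk | hlk
    · exact absurd ((hf hlk).2.trans hk) (not_le.2 hl')
    · exact absurd ((hf hlk).1.trans hl) (not_le.2 hk')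
  rcases h3 with h | h
  · have : (∑ l, if f l ≤ p then t l else 0) = ∑ l, if (f l).1 ≤ p.1 then t l else 0 :=
      Finset.sum_congr rfl fun l _ => if_congr ⟨fun h' => h'.1, fun h' => ⟨h', h l h'⟩⟩ rfl rfl
    rw [← this, min_eq_left h2]
  · have : (∑ l, if f l ≤ p then t l else 0) = ∑ l, if (f l).2 ≤ p.2 then t l else 0 :=
      Finset.sum_congr rfl fun l _ => if_congr ⟨fun h' => h'.2, fun h' => ⟨h l h', h'⟩⟩ rfl rfl
    rw [← this, min_eq_right h1]

/-- Weights on a strict chain in a product of linear orders are determined by their marginals. -/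
lemma chain_eq_of_marginals [Fintype P] [Fintype Q] {m m' : ℕ} (f : Fin (m + 1) → P × Q) (f' : Fin (m' + 1) → P × Q)
    (hf : StrictMono f) (hf' : StrictMono f') {t : Fin (m + 1) → ℝ} {t' : Fin (m' + 1) → ℝ}
    (ht : ∀ l, 0 < t l) (ht' : ∀ l, 0 < t' l)
    (h1 : ∀ i, weightAt (fun l => (f l).1) t i = weightAt (fun l => (f' l).1) t' i)
    (h2 : ∀ i, weightAt (fun l => (f l).2) t i = weightAt (fun l => (f' l).2) t' i) :
    ∃ h : m = m', (∀ l, f l = f' (Fin.cast (by rw [h]) l)) ∧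
      ∀ l, t l = t' (Fin.cast (by rw [h]) l) := by
  -- The cumulative sums of the joint weights are minima of cumulative sums of the marginals, so
  -- both chains carry the same weight function. Its support and values then give back the chain and
  -- its weights.
  have hw : weightAt f t = weightAt f' t' := by
    refine eq_of_sum_Iic_eq fun p => ?_
    rw [sum_weightAt, sum_weightAt, sum_chain_eq_min f hf.monotone (fun l => (ht l).le),
      sum_chain_eq_min f' hf'.monotone (fun l => (ht' l).le)]
    rw [← sum_weightAt (fun l => (f l).1) t (· ≤ p.1), ← sum_weightAt (fun l => (f l).2) t (· ≤ p.2),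
      ← sum_weightAt (fun l => (f' l).1) t' (· ≤ p.1),
      ← sum_weightAt (fun l => (f' l).2) t' (· ≤ p.2)]
    simp only [h1, h2]
  have hat : ∀ {k : ℕ} (g : Fin (k + 1) → P × Q) (_ : StrictMono g) (s : Fin (k + 1) → ℝ) (l),
      weightAt g s (g l) = s l := by
    intro k g hg s l
    unfold weightAt
    rw [Finset.sum_eq_single l]
    · simp
    · intro j _ hj
      simp [hg.injective.ne hj]
    · simp
  have hout : ∀ {k : ℕ} (g : Fin (k + 1) → P × Q) (s : Fin (k + 1) → ℝ) (x),
      weightAt g s x ≠ 0 → x ∈ Set.range g := by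
    intro k g s x hx
    obtain ⟨l, _, hl⟩ := Finset.exists_ne_zero_of_sum_ne_zero hx
    exact ⟨l, by by_contra h; simp [h] at hl⟩
  have hr : Set.range f = Set.range f' := by
    apply Set.Subset.antisymm
    · rintro _ ⟨l, rfl⟩
      refine hout f' t' _ ?_
      rw [← hw, hat f hf]
      exact (ht l).ne'
    · rintro _ ⟨l, rfl⟩
      refine hout f t _ ?_
      rw [hw, hat f' hf']
      exact (ht' l).ne'
  have hm : m = m' := by
    have e1 := Set.card_range_of_injective hf.injective
    have e2 := Set.card_range_of_injective hf'.injective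
    simp only [hr, Fintype.card_fin] at e1 e2
    omega
  subst hm
  have hff : f = f' := (StrictMono.range_inj hf hf').1 hr
  subst hff
  refine ⟨rfl, fun l => rfl, fun l => ?_⟩
  rw [← hat f hf t l, hw, hat f hf]
  rfl

end Coupling

/-- The prism on a standard simplex. -/
abbrev prism (n : SimplexCategory) : SSet.{u} :=
  SSet.stdSimplex.obj n ⊗ SSet.stdSimplex.obj ⦋1⦌

/-- The comparison map from the realization of a prism to the topological prism. -/
noncomputable def prismMap (n : SimplexCategory) :
    C(SSet.toTop.obj (prism.{u} n), TopSimplex n × TopSimplex ⦋1⦌) where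
  toFun p := (n.toTopHomeo (SSet.toTop.map (fst _ _) p),
    SimplexCategory.toTopHomeo ⦋1⦌ (SSet.toTop.map (snd _ _) p))
  continuous_toFun := by fun_prop

lemma toTopHomeo_realPt {n m : SimplexCategory} (f : (SSet.stdSimplex.{u}.obj n).obj (op m))
    (t : TopSimplex m) :
    n.toTopHomeo (realPt f t) = TopSimplex.map (SSet.stdSimplex.objEquiv f) t := by
  obtain ⟨f, rfl⟩ := SSet.stdSimplex.objEquiv.symm.surjective f
  unfold realPt
  rw [← SSet.yonedaEquiv_map, Equiv.symm_apply_apply, SimplexCategory.toTopHomeo_naturality_apply,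
    Homeomorph.apply_symm_apply, SSet.yonedaEquiv_map, Equiv.apply_symm_apply]
  rfl

lemma prismMap_realPt {n m : SimplexCategory} (σ : (prism.{u} n).obj (op m)) (t : TopSimplex m) :
    prismMap n (realPt σ t) = (TopSimplex.map (SSet.stdSimplex.objEquiv σ.1) t,
      TopSimplex.map (SSet.stdSimplex.objEquiv σ.2) t) := by
  change (n.toTopHomeo (SSet.toTop.map (fst _ _) (realPt σ t)),
    SimplexCategory.toTopHomeo ⦋1⦌ (SSet.toTop.map (snd _ _) (realPt σ t))) = _
  rw [map_realPt, map_realPt, toTopHomeo_realPt, toTopHomeo_realPt]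
  rfl

/-- Nondegenerate simplices of Δ[n] × Δ[1] are strict chains, and the two components of `prismMap`
are the marginals of the weights on the chain. -/
lemma prismMap_injective (n : SimplexCategory) : Function.Injective (prismMap.{u} n) := by
  intro p q h
  obtain ⟨m, ⟨σ, hσ⟩, t, ht, rfl⟩ := exists_normal p
  obtain ⟨m', ⟨σ', hσ'⟩, t', ht', rfl⟩ := exists_normal q
  induction n using SimplexCategory.rec with | _ n
  have hs := (SSet.prodStdSimplex.nonDegenerate_iff_strictMono_objEquiv σ).1 hσ
  have hs' := (SSet.prodStdSimplex.nonDegenerate_iff_strictMono_objEquiv σ').1 hσ'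
  rw [prismMap_realPt, prismMap_realPt] at h
  obtain ⟨rfl, hf, he⟩ := chain_eq_of_marginals _ _ hs hs' ht ht'
    (fun i => by
      have := congrArg (fun z => z.1 i) h
      simp only [TopSimplex.map_apply] at this
      exact this)
    (fun i => by
      have := congrArg (fun z => z.2 i) h
      simp only [TopSimplex.map_apply] at this
      exact this)
  have h1 : σ = σ' := SSet.prodStdSimplex.objEquiv.injective (OrderHom.ext _ _ (funext hf))
  have h2 : t = t' := stdSimplex.ext (funext he)
  subst h1
  rw [h2]

/-- The morphism to `⦋1⦌` that sends the first `i + 1` elements to `0`. -/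
def stepHom {n : ℕ} (i : Fin (n + 1)) : ⦋n + 1⦌ ⟶ ⦋1⦌ :=
  SimplexCategory.Hom.mk
    ⟨fun l => if l ≤ i.castSucc then 0 else 1, fun l k hlk => by
      dsimp only
      split_ifs with h1 h2 h2
      · exact le_rfl
      · exact Fin.zero_le _
      · exact absurd (hlk.trans h2) h1
      · exact le_rfl⟩

/-- The maximal simplices of a prism. -/
def prismSimplex {n : ℕ} (i : Fin (n + 1)) : (prism.{u} ⦋n⦌).obj (op ⦋n + 1⦌) :=
  (SSet.stdSimplex.objEquiv.symm (SimplexCategory.σ i), SSet.stdSimplex.objEquiv.symm (stepHom i))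

/-- The total weight is cut at level r: i is the index where the running sum crosses r, and a is the
part of `t i` below the cut. -/
lemma exists_split {n : ℕ} (t : Fin (n + 1) → ℝ) (ht : ∀ i, 0 ≤ t i) (r : ℝ) (hr : 0 ≤ r)
    (hr' : r ≤ ∑ i, t i) : ∃ (i : Fin (n + 1)) (a : ℝ), 0 ≤ a ∧ a ≤ t i ∧
      (∑ k, if k < i then t k else 0) + a = r := by
  induction n generalizing r with
  | zero => exact ⟨0, r, hr, by simpa using hr', by simp⟩
  | succ n ih =>
    rw [Fin.sum_univ_succ] at hr'
    rcases le_total r (t 0) with h | h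
    · exact ⟨0, r, hr, h, by simp⟩
    · obtain ⟨i, a, ha, ha', hs⟩ := ih (fun k => t k.succ) (fun k => ht _)
        (r - t 0) (by linarith) (by linarith)
      refine ⟨i.succ, a, ha, ha', ?_⟩
      rw [Fin.sum_univ_succ]
      simp only [Fin.succ_pos, if_true, Fin.succ_lt_succ_iff]
      linarith

lemma exists_prismSimplex {n : ℕ} (t : TopSimplex ⦋n⦌) (s : TopSimplex ⦋1⦌) :
    ∃ (i : Fin (n + 1)) (v : TopSimplex ⦋n + 1⦌),
      prismMap.{u} ⦋n⦌ (realPt (prismSimplex i) v) = (t, s) := by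
  have hs1 : s 0 + s 1 = 1 := stdSimplex.add_eq_one s
  have hs0 : s 0 ≤ 1 := by linarith [stdSimplex.zero_le s 1]
  obtain ⟨i, a, ha, ha', hsum⟩ := exists_split (fun k => t k) (stdSimplex.zero_le t)
    (s 0) (stdSimplex.zero_le s 0) (by rw [stdSimplex.sum_eq_one t]; exact hs0)
  -- The vertices up to i lie over 0 and those from i on over 1, so vertex i occurs twice: at
  -- position `i.castSucc` with weight a, and at `i.succ` with the remaining weight `t i - a`. The
  -- lower copies then have total weight `s 0`.
  let w : Fin (n + 2) → ℝ := Fin.insertNth (α := fun _ => ℝ) i.succ (t i - a)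
    (Function.update (fun k => t k) i a)
  have hw1 : w i.succ = t i - a := Fin.insertNth_apply_same _ _ _
  have hw2 : ∀ k, w (i.succ.succAbove k) = Function.update (fun k => t k) i a k :=
    fun k => Fin.insertNth_apply_succAbove _ _ _ _
  have hupd : ∀ k, Function.update (fun k => t k) i a k = t k + if k = i then a - t i else 0 := by
    intro k
    by_cases hk : k = i
    · subst hk
      simp
    · simp [hk]
  have hw0 : ∀ l, 0 ≤ w l := by
    intro l
    rcases Fin.eq_self_or_eq_succAbove i.succ l with rfl | ⟨k, rfl⟩
    · rw [hw1]
      linarith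
    · rw [hw2]
      by_cases hk : k = i
      · subst hk
        simp [ha]
      · simp [hk]
  have hwsum : ∑ l, w l = 1 := by
    rw [Fin.sum_univ_succAbove _ i.succ, hw1]
    simp only [hw2, hupd, Finset.sum_add_distrib, Finset.sum_ite_eq', Finset.mem_univ, if_true]
    have := stdSimplex.sum_eq_one t
    linarith
  let v : TopSimplex ⦋n + 1⦌ := ⟨w, hw0, hwsum⟩
  refine ⟨i, v, ?_⟩
  rw [prismMap_realPt]
  refine Prod.ext ?_ ?_
  · refine stdSimplex.ext (funext fun j => ?_)
    change TopSimplex.map (SimplexCategory.σ i) v j = t j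
    rw [TopSimplex.map_apply]
    change ∑ l : Fin (n + 2), (if i.predAbove l = j then w l else 0) = _
    rw [Fin.sum_univ_succAbove _ i.succ]
    have hpred : ∀ k, i.predAbove (i.succ.succAbove k) = k := fun k => by
      rcases lt_or_ge i k with hk | hk
      · rw [Fin.succAbove_of_lt_succ _ _ (by simpa using hk), Fin.predAbove_succ_of_le _ _ hk.le]
      · rw [Fin.succAbove_of_castSucc_lt _ _ (Fin.castSucc_lt_succ_iff.2 hk),
          Fin.predAbove_castSucc_of_le _ _ hk]
    simp only [hw1, hw2, hupd, Fin.predAbove_succ_self, hpred, Finset.sum_ite_eq',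
      Finset.mem_univ, if_true]
    by_cases hj : j = i
    · subst hj
      simp
    · simp [hj, Ne.symm hj]
  · have h0 : TopSimplex.map (stepHom i) v 0 = s 0 := by
      rw [TopSimplex.map_apply]
      change ∑ l : Fin (n + 2), (if (if l ≤ i.castSucc then (0 : Fin 2) else 1) = 0
        then w l else 0) = _
      rw [Fin.sum_univ_succAbove _ i.succ]
      have hle : ∀ k, i.succ.succAbove k ≤ i.castSucc ↔ k ≤ i := fun k => by
        rcases lt_or_ge i k with hk | hk
        · rw [Fin.succAbove_of_lt_succ _ _ (by simpa using hk)]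
          exact ⟨fun h => absurd (Fin.succ_le_castSucc_iff.1 h) hk.not_gt, fun h => absurd h hk.not_ge⟩
        · rw [Fin.succAbove_of_castSucc_lt _ _ (Fin.castSucc_lt_succ_iff.2 hk)]
          exact Fin.castSucc_le_castSucc_iff
      have hi : ¬ i.succ ≤ i.castSucc := by simp
      have hterm : ∀ k, (if (if i.succ.succAbove k ≤ i.castSucc then (0 : Fin 2) else 1) = 0
          then w (i.succ.succAbove k) else 0) =
          (if k < i then t k else 0) + if k = i then a else 0 := fun k => by
        rw [hw2, hupd]
        simp only [hle]
        rcases lt_trichotomy k i with hk | rfl | hk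
        · simp [hk, hk.le, hk.ne]
        · simp
        · simp [hk.not_ge, hk.not_gt, hk.ne']
      simp only [hterm, hi, if_false, Finset.sum_add_distrib, Finset.sum_ite_eq',
        Finset.mem_univ, if_true]
      simpa using hsum
    have h1 : TopSimplex.map (stepHom i) v 0 + TopSimplex.map (stepHom i) v 1 = 1 :=
      stdSimplex.add_eq_one (TopSimplex.map (stepHom i) v)
    refine stdSimplex.ext (funext fun j => ?_)
    change TopSimplex.map (stepHom i) v j = s j
    fin_cases j
    · exact h0
    · change TopSimplex.map (stepHom i) v 1 = s 1
      linarith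

lemma prismMap_surjective (n : SimplexCategory) : Function.Surjective (prismMap.{u} n) := by
  induction n using SimplexCategory.rec with | _ n
  rintro ⟨t, s⟩
  obtain ⟨i, v, h⟩ := exists_prismSimplex t s
  exact ⟨_, h⟩

/-- The finitely many maximal simplices already cover the topological prism, so by injectivity of
`prismMap` they cover the realization. Compactness is what upgrades the continuous bijection to a
homeomorphism. -/
lemma compactSpace_prism (n : SimplexCategory) :
    CompactSpace (SSet.toTop.obj (prism.{u} n)) := by
  induction n using SimplexCategory.rec with | _ n
  have h : (Set.univ : Set (SSet.toTop.obj (prism.{u} ⦋n⦌))) =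
      ⋃ i : Fin (n + 1), Set.range (realPt (prismSimplex.{u} i)) := by
    refine (Set.eq_univ_of_forall fun p => ?_).symm
    obtain ⟨i, v, hv⟩ := exists_prismSimplex.{u} (prismMap ⦋n⦌ p).1 (prismMap ⦋n⦌ p).2
    exact Set.mem_iUnion.2 ⟨i, v, prismMap_injective _ hv⟩
  refine ⟨?_⟩
  rw [h]
  exact isCompact_iUnion fun i => isCompact_range (continuous_realPt _)

/-- The realization of a prism is the topological prism. -/
noncomputable def prismHomeo (n : SimplexCategory) :
    SSet.toTop.obj (prism.{u} n) ≃ₜ TopSimplex n × TopSimplex ⦋1⦌ :=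
  haveI := compactSpace_prism.{u} n
  (prismMap n).continuous.homeoOfEquivCompactToT2
    (f := Equiv.ofBijective _ ⟨prismMap_injective n, prismMap_surjective n⟩)

lemma prismHomeo_apply (n : SimplexCategory) (p : SSet.toTop.obj (prism.{u} n)) :
    prismHomeo n p = prismMap n p := rfl

/-! ## Homotopies from maps out of prisms -/

variable {X Y : SSet.{u}}

lemma prismMap_naturality {n m : SimplexCategory} (f : m ⟶ n) (p : SSet.toTop.obj (prism.{u} m)) :
    prismMap n (SSet.toTop.map (SSet.stdSimplex.map f ▷ _) p)
      = (TopSimplex.map f (prismMap m p).1, (prismMap m p).2) := by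
  obtain ⟨k, σ, t, rfl⟩ := exists_realPt p
  rw [map_realPt, prismMap_realPt, prismMap_realPt]
  refine Prod.ext ?_ rfl
  exact TopSimplex.map_comp _ _ _

/-- The compatible family of homotopies on simplices induced by a map out of a cylinder. -/
noncomputable def homotopyCocone (φ : X ⊗ SSet.stdSimplex.obj ⦋1⦌ ⟶ Y) :
    RealCocone X C(TopSimplex ⦋1⦌, SSet.toTop.obj Y) where
  map {n} σ := ContinuousMap.curry
    ((SSet.toTop.map (SSet.yonedaEquiv.symm σ ▷ _ ≫ φ)).hom.comp
      ⟨(prismHomeo n).symm, (prismHomeo n).symm.continuous⟩)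
  compat {n m} f σ t := by
    ext s
    change SSet.toTop.map _ ((prismHomeo m).symm (t, s)) =
      SSet.toTop.map _ ((prismHomeo n).symm (TopSimplex.map f t, s))
    have h : (prismHomeo n).symm (TopSimplex.map f t, s) =
        SSet.toTop.map (SSet.stdSimplex.map f ▷ _) ((prismHomeo m).symm (t, s)) := by
      rw [Homeomorph.symm_apply_eq, prismHomeo_apply, prismMap_naturality, ← prismHomeo_apply,
        Homeomorph.apply_symm_apply]
    rw [h, ← SSet.yonedaEquiv_symm_naturality_left, comp_whiskerRight, Category.assoc,
      Functor.map_comp]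
    rfl

/-- The homotopy induced by a map of simplicial sets out of a cylinder. -/
noncomputable def realHomotopy (φ : X ⊗ SSet.stdSimplex.obj ⦋1⦌ ⟶ Y) :
    C(SSet.toTop.obj X × TopSimplex ⦋1⦌, SSet.toTop.obj Y) :=
  -- The family is descended with values in a mapping space, so no product of the whole realization
  -- with an interval has to be presented as a colimit; uncurrying is continuous because the
  -- topological 1-simplex is locally compact.
  (homotopyCocone φ).desc.uncurry

lemma realHomotopy_realPt (φ : X ⊗ SSet.stdSimplex.obj ⦋1⦌ ⟶ Y) {n : SimplexCategory}
    (σ : X.obj (op n)) (t : TopSimplex n) (s : TopSimplex ⦋1⦌) :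
    realHomotopy φ (realPt σ t, s) =
      SSet.toTop.map (SSet.yonedaEquiv.symm σ ▷ _ ≫ φ) ((prismHomeo n).symm (t, s)) :=
  congrArg (fun k : C(TopSimplex ⦋1⦌, SSet.toTop.obj Y) => k s) ((homotopyCocone φ).desc_realPt σ t)

lemma realHomotopy_naturality {Z : SSet.{u}} (φ : X ⊗ SSet.stdSimplex.obj ⦋1⦌ ⟶ Y) (ψ : Y ⟶ Z)
    (p : SSet.toTop.obj X) (s : TopSimplex ⦋1⦌) :
    SSet.toTop.map ψ (realHomotopy φ (p, s)) = realHomotopy (φ ≫ ψ) (p, s) := by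
  obtain ⟨n, σ, t, rfl⟩ := exists_realPt p
  rw [realHomotopy_realPt, realHomotopy_realPt, ← Category.assoc, Functor.map_comp _ _ ψ]
  rfl

/-- A cylinder map factoring through the projection gives a stationary homotopy; this is what makes
the final homotopy fibrewise. -/
lemma realHomotopy_fst (ψ : X ⟶ Y) (p : SSet.toTop.obj X) (s : TopSimplex ⦋1⦌) :
    realHomotopy (fst _ _ ≫ ψ) (p, s) = SSet.toTop.map ψ p := by
  obtain ⟨n, σ, t, rfl⟩ := exists_realPt p
  obtain ⟨q, hq⟩ := (prismHomeo.{u} n).surjective (t, s)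
  have hq1 : n.toTopHomeo (SSet.toTop.map (fst _ _) q) = t := congrArg Prod.fst hq
  rw [realHomotopy_realPt, ← hq, Homeomorph.symm_apply_apply, whiskerRight_fst_assoc,
    Functor.map_comp, Functor.map_comp]
  change SSet.toTop.map ψ (SSet.toTop.map (SSet.yonedaEquiv.symm σ) (SSet.toTop.map (fst _ _) q)) = _
  unfold realPt
  rw [← hq1, Homeomorph.symm_apply_apply]

lemma TopSimplex.map_const {n m : SimplexCategory} (f : n ⟶ m) (t : TopSimplex n)
    (j : Fin (m.len + 1)) (h : ∀ i, f i = j) : TopSimplex.map f t = stdSimplex.vertex j := by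
  refine stdSimplex.ext (funext fun k => ?_)
  change TopSimplex.map f t k = (stdSimplex.vertex (S := ℝ) j : Fin (m.len + 1) → ℝ) k
  rw [map_apply, stdSimplex.vertex_coe]
  simp only [h]
  by_cases hk : k = j
  · subst hk
    simp
  · simp [hk, Ne.symm hk]

/-- The inclusion of an end of the cylinder. -/
noncomputable def cylinderEnd (X : SSet.{u}) (j : Fin 2) : X ⟶ X ⊗ SSet.stdSimplex.obj ⦋1⦌ :=
  lift (𝟙 X) (SSet.const (SSet.stdSimplex.objEquiv.symm (SimplexCategory.const ⦋0⦌ ⦋1⦌ j)))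

lemma realHomotopy_vertex (φ : X ⊗ SSet.stdSimplex.obj ⦋1⦌ ⟶ Y) (j : Fin 2)
    (p : SSet.toTop.obj X) :
    realHomotopy φ (p, stdSimplex.vertex j) = SSet.toTop.map (cylinderEnd X j ≫ φ) p := by
  obtain ⟨n, σ, t, rfl⟩ := exists_realPt p
  have h : (prismHomeo.{u} n).symm (t, stdSimplex.vertex j) =
      SSet.toTop.map (cylinderEnd _ j) (n.toTopHomeo.symm t) := by
    rw [Homeomorph.symm_apply_eq, prismHomeo_apply]
    obtain ⟨m, τ, v, hv⟩ := exists_realPt (n.toTopHomeo.symm t)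
    have ht : t = n.toTopHomeo (realPt τ v) := by rw [hv, Homeomorph.apply_symm_apply]
    rw [← hv, map_realPt, prismMap_realPt, ht, toTopHomeo_realPt]
    exact Prod.ext rfl (TopSimplex.map_const _ v j fun _ => rfl).symm
  rw [realHomotopy_realPt, h]
  have h2 : cylinderEnd (SSet.stdSimplex.obj n) j ≫ SSet.yonedaEquiv.symm σ ▷ _ ≫ φ
      = SSet.yonedaEquiv.symm σ ≫ cylinderEnd X j ≫ φ := by
    rw [← Category.assoc, ← Category.assoc]
    congr 1
  unfold realPt
  change (SSet.toTop.map _ ≫ SSet.toTop.map _) (n.toTopHomeo.symm t) =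
    (SSet.toTop.map _ ≫ SSet.toTop.map _) (n.toTopHomeo.symm t)
  rw [← Functor.map_comp, ← Functor.map_comp, h2]

end Prism
end Elmendorf

namespace Elmendorf

section Nerves

open Simplicial MonoidalCategory CartesianMonoidalCategory

/-! ## Natural transformations and homotopies of classifying spaces -/

variable {C D E : Type u} [Category.{u} C] [Category.{u} D] [Category.{u} E]

/-- The functor `Fin 2 × C ⥤ D` corresponding to a natural transformation. -/
def cylinderFunctor {F F' : C ⥤ D} (θ : F ⟶ F') : Fin 2 × C ⥤ D :=
  Functor.uncurry.obj (ComposableArrows.mk₁ θ)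

/-- Morphisms of `Fin 2 × C` lie over 0 → 0, 1 → 1 or 0 → 1, so three comparisons determine a
functor. -/
lemma cylinderFunctor_hext {F F' : C ⥤ D} (θ : F ⟶ F') {K : Fin 2 × C ⥤ D}
    (h₀ : ∀ c, F.obj c = K.obj (0, c)) (h₁ : ∀ c, F'.obj c = K.obj (1, c))
    (h₀₀ : ∀ {c d : C} (f : c ⟶ d), HEq (F.map f) (K.map (CategoryTheory.Prod.mkHom (𝟙 (0 : Fin 2)) f)))
    (h₁₁ : ∀ {c d : C} (f : c ⟶ d), HEq (F'.map f) (K.map (CategoryTheory.Prod.mkHom (𝟙 (1 : Fin 2)) f)))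
    (h₀₁ : ∀ {c d : C} (f : c ⟶ d), HEq (θ.app c ≫ F'.map f)
      (K.map (CategoryTheory.Prod.mkHom (homOfLE (Fin.zero_le (1 : Fin 2))) f))) :
    cylinderFunctor θ = K := by
  refine Functor.hext ?_ ?_
  · rintro ⟨i, c⟩
    fin_cases i
    · exact h₀ c
    · exact h₁ c
  · rintro ⟨i, c⟩ ⟨j, d⟩ ⟨f, g⟩
    fin_cases i <;> fin_cases j
    · obtain rfl : f = 𝟙 _ := Subsingleton.elim _ _
      refine HEq.trans (heq_of_eq ?_) (h₀₀ g)
      exact (Category.id_comp _)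
    · obtain rfl : f = homOfLE (Fin.zero_le 1) := Subsingleton.elim _ _
      exact h₀₁ g
    · exact absurd (leOfHom f : (1 : Fin 2) ≤ 0) (by decide)
    · obtain rfl : f = 𝟙 _ := Subsingleton.elim _ _
      refine HEq.trans (heq_of_eq ?_) (h₁₁ g)
      exact (Category.id_comp _)

/-- The simplicial homotopy of nerves induced by a natural transformation. -/
def nerveCylinder {F F' : C ⥤ D} (θ : F ⟶ F') :
    nerve C ⊗ SSet.stdSimplex.obj ⦋1⦌ ⟶ nerve D where
  app _ := ↾fun σ => Functor.prod' (SSet.stdSimplex.objEquiv σ.2).toOrderHom.monotone.functor σ.1 ⋙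
    cylinderFunctor θ
  naturality _ _ _ := rfl

lemma nerveCylinder_comp {F F' : C ⥤ D} (θ : F ⟶ F') (P : D ⥤ E) :
    nerveCylinder θ ≫ nerveMap P = nerveCylinder (Functor.whiskerRight θ P) := by
  have h : cylinderFunctor (Functor.whiskerRight θ P) = cylinderFunctor θ ⋙ P := by
    refine cylinderFunctor_hext _ (fun _ => rfl) (fun _ => rfl) (fun f => heq_of_eq ?_)
      (fun f => heq_of_eq ?_) (fun f => heq_of_eq ?_)
    · exact congrArg P.map (Category.id_comp (F.map f)).symm
    · exact congrArg P.map (Category.id_comp (F'.map f)).symm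
    · exact (P.map_comp _ _).symm
  ext n σ
  change (Functor.prod' _ σ.1 ⋙ cylinderFunctor θ) ⋙ P = Functor.prod' _ σ.1 ⋙ cylinderFunctor _
  rw [h]
  rfl

lemma nerveCylinder_id (F : C ⥤ D) : nerveCylinder (𝟙 F) = fst _ _ ≫ nerveMap F := by
  have h : cylinderFunctor (𝟙 F) = CategoryTheory.Prod.snd _ _ ⋙ F := by
    refine cylinderFunctor_hext _ (fun _ => rfl) (fun _ => rfl) (fun f => HEq.rfl)
      (fun f => HEq.rfl) (fun f => heq_of_eq ?_)
    exact Category.id_comp _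
  ext n σ
  change Functor.prod' _ σ.1 ⋙ cylinderFunctor _ = σ.1 ⋙ F
  rw [h]
  rfl

/-- Needed with `eqToHom` in place of an identity because P and P ∘ S ∘ P agree only propositionally
when S is a section of P. -/
lemma nerveCylinder_of_eq {F F' : C ⥤ D} (θ : F ⟶ F') (h : F = F') (hθ : θ = eqToHom h) :
    nerveCylinder θ = fst _ _ ≫ nerveMap F := by
  subst h
  rw [hθ]
  exact nerveCylinder_id F

lemma cylinderEnd_zero {F F' : C ⥤ D} (θ : F ⟶ F') :
    cylinderEnd (nerve C) 0 ≫ nerveCylinder θ = nerveMap F := by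
  ext n σ
  refine Functor.hext (fun _ => rfl) fun i j f => heq_of_eq ?_
  exact Category.id_comp _

lemma cylinderEnd_one {F F' : C ⥤ D} (θ : F ⟶ F') :
    cylinderEnd (nerve C) 1 ≫ nerveCylinder θ = nerveMap F' := by
  ext n σ
  refine Functor.hext (fun _ => rfl) fun i j f => heq_of_eq ?_
  exact Category.id_comp _

/-- The homotopy of realized nerves induced by a natural transformation. -/
noncomputable def nerveHomotopy {F F' : C ⥤ D} (θ : F ⟶ F') :
    C(SSet.toTop.obj (nerve C) × unitInterval, SSet.toTop.obj (nerve D)) :=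
  (realHomotopy (nerveCylinder θ)).comp
    ⟨fun p => (p.1, stdSimplexHomeomorphUnitInterval.symm p.2), by fun_prop⟩

lemma nerveHomotopy_zero {F F' : C ⥤ D} (θ : F ⟶ F') (x : SSet.toTop.obj (nerve C)) :
    nerveHomotopy θ (x, 0) = SSet.toTop.map (nerveMap F) x := by
  have h : stdSimplexHomeomorphUnitInterval.symm 0 = stdSimplex.vertex (S := ℝ) (0 : Fin 2) := by
    rw [Homeomorph.symm_apply_eq]
    rfl
  change realHomotopy _ (x, stdSimplexHomeomorphUnitInterval.symm 0) = _
  rw [h, ← cylinderEnd_zero θ]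
  exact realHomotopy_vertex _ _ _

lemma nerveHomotopy_one {F F' : C ⥤ D} (θ : F ⟶ F') (x : SSet.toTop.obj (nerve C)) :
    nerveHomotopy θ (x, 1) = SSet.toTop.map (nerveMap F') x := by
  have h : stdSimplexHomeomorphUnitInterval.symm 1 = stdSimplex.vertex (S := ℝ) (1 : Fin 2) := by
    rw [Homeomorph.symm_apply_eq]
    rfl
  change realHomotopy _ (x, stdSimplexHomeomorphUnitInterval.symm 1) = _
  rw [h, ← cylinderEnd_one θ]
  exact realHomotopy_vertex _ _ _

lemma map_nerveHomotopy_of_eq {F F' : C ⥤ D} (θ : F ⟶ F') (P : D ⥤ E) (h : F ⋙ P = F' ⋙ P)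
    (hθ : Functor.whiskerRight θ P = eqToHom h) (x : SSet.toTop.obj (nerve C)) (s : unitInterval) :
    SSet.toTop.map (nerveMap P) (nerveHomotopy θ (x, s))
      = SSet.toTop.map (nerveMap (F ⋙ P)) x := by
  change SSet.toTop.map (nerveMap P) (realHomotopy _ (x, _)) = _
  rw [realHomotopy_naturality, nerveCylinder_comp, nerveCylinder_of_eq _ h hθ, realHomotopy_fst]

/-- A retraction of categories with a natural transformation from the identity lying over identity
morphisms induces a fibrewise retraction of classifying spaces. -/
noncomputable def classifyingRetract {C D : Cat.{u, u}} (P : C ⟶ D) (S : D ⟶ C)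
    (h : S ≫ P = 𝟙 D) (θ : 𝟭 C ⟶ P.toFunctor ⋙ S.toFunctor)
    (hθ : ∀ c, HEq (P.toFunctor.map (θ.app c)) (𝟙 (P.toFunctor.obj c))) :
    FiberwiseRetract (classifyingSpace.map P).hom where
  section' := (classifyingSpace.map S).hom
  right_inv y := by
    have := congrArg (fun k => k.hom y) (classifyingSpace.map_comp S P)
    rw [h, classifyingSpace.map_id] at this
    exact this.symm
  homotopy := nerveHomotopy θ
  homotopy_zero x := (nerveHomotopy_zero θ x).trans
    (congrArg (fun k => k.hom x) (classifyingSpace.map_id C))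
  homotopy_one x := (nerveHomotopy_one θ x).trans
    (congrArg (fun k => k.hom x) (classifyingSpace.map_comp P S))
  map_homotopy x s := by
    have hF : 𝟭 C ⋙ P.toFunctor = (P.toFunctor ⋙ S.toFunctor) ⋙ P.toFunctor :=
      congrArg (fun k => P.toFunctor ⋙ Cat.Hom.toFunctor k) h.symm
    refine map_nerveHomotopy_of_eq θ P.toFunctor hF ?_ x s
    ext c
    refine eq_of_heq ((hθ c).trans ?_)
    rw [eqToHom_app]
    exact (eqToHom_heq_id_dom _ _ _).symm

end Nerves
end Elmendorf

namespace Elmendorf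

section FixedPoints

/-! ## Fixed points of `G`-categories -/

variable {G : Type u} [Group G]

lemma act_mul (A : Action Cat.{u, u} G) (g g' : G) : act A (g * g') = act A g' ⋙ act A g :=
  congrArg Cat.Hom.toFunctor (map_mul A.ρ g g')

lemma act_one (A : Action Cat.{u, u} G) : act A 1 = 𝟭 _ :=
  congrArg Cat.Hom.toFunctor (map_one A.ρ)

lemma act_obj_mul (A : Action Cat.{u, u} G) (g g' : G) (a : A.V) :
    (act A (g * g')).obj a = (act A g).obj ((act A g').obj a) :=
  Functor.congr_obj (act_mul A g g') a

lemma act_obj_one (A : Action Cat.{u, u} G) (a : A.V) : (act A 1).obj a = a :=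
  Functor.congr_obj (act_one A) a

lemma act_map_mul (A : Action Cat.{u, u} G) (g g' : G) {a b : A.V} (f : a ⟶ b) :
    HEq ((act A (g * g')).map f) ((act A g).map ((act A g').map f)) :=
  Functor.hcongr_hom (act_mul A g g') f

lemma act_map_one (A : Action Cat.{u, u} G) {a b : A.V} (f : a ⟶ b) :
    HEq ((act A 1).map f) f :=
  Functor.hcongr_hom (act_one A) f

lemma coset_eq_smul_one {L : Orb G} (g : G) : ((g : G ⧸ L.sub) : L.Coset) = g • L.one :=
  congrArg (QuotientGroup.mk (s := L.sub)) (mul_one g).symm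

lemma smul_one_of_mem {L : Orb G} {l : G} (hl : l ∈ L.sub) : l • L.one = L.one := by
  rw [← coset_eq_smul_one]
  exact QuotientGroup.eq.2 (by simpa using hl)

variable {A : Action Cat.{u, u} G} {L : Orb G}

lemma GFun.obj_coset (y : GFun (discObj L) A) (g : G) :
    y.functor.obj (Discrete.mk ((g : G ⧸ L.sub) : L.Coset))
      = (act A g).obj (y.functor.obj (Discrete.mk L.one)) := by
  rw [coset_eq_smul_one]
  exact (GFun.obj_act y g (Discrete.mk L.one)).symm

lemma GNatTrans.app_coset {y y' : GFun (discObj L) A} (φ : GNatTrans y y') (g : G) :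
    HEq (φ.nat.app (Discrete.mk ((g : G ⧸ L.sub) : L.Coset)))
      ((act A g).map (φ.nat.app (Discrete.mk L.one))) := by
  rw [coset_eq_smul_one]
  exact (φ.equivariant g (Discrete.mk L.one)).symm

lemma heq_id {C : Type*} [Category* C] {x y : C} (h : x = y) : HEq (𝟙 x) (𝟙 y) := by
  subst h
  rfl

lemma functor_hext_of_discrete {I : Type*} {C : Type*} [Category* C] {F F' : Discrete I ⥤ C}
    (h : ∀ i, F.obj (Discrete.mk i) = F'.obj (Discrete.mk i)) : F = F' := by
  refine Functor.hext (fun i => h i.as) ?_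
  rintro ⟨i⟩ ⟨j⟩ f
  obtain rfl : i = j := Discrete.eq_of_hom f
  obtain rfl : f = 𝟙 _ := Subsingleton.elim _ _
  rw [CategoryTheory.Functor.map_id, CategoryTheory.Functor.map_id]
  exact heq_id (h i)

lemma GFun.ext_one {y y' : GFun (discObj L) A}
    (h : y.functor.obj (Discrete.mk L.one) = y'.functor.obj (Discrete.mk L.one)) : y = y' := by
  refine Action.Hom.ext (Cat.ext (functor_hext_of_discrete fun c => ?_))
  induction c using Quotient.inductionOn' with
  | h g => exact (y.obj_coset g).trans ((congrArg _ h).trans (y'.obj_coset g).symm)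

lemma GNatTrans.ext_one {y y' : GFun (discObj L) A} {φ φ' : GNatTrans y y'}
    (h : φ.nat.app (Discrete.mk L.one) = φ'.nat.app (Discrete.mk L.one)) : φ = φ' := by
  refine GNatTrans.ext (NatTrans.ext (funext fun c => ?_))
  obtain ⟨c⟩ := c
  induction c using Quotient.inductionOn' with
  | h g =>
    exact eq_of_heq ((φ.app_coset g).trans ((heq_of_eq (congrArg _ h)).trans (φ'.app_coset g).symm))

lemma GNatTrans.hext_one {y y' w w' : GFun (discObj L) A} {φ : GNatTrans y w}
    {φ' : GNatTrans y' w'} (hy : y = y') (hw : w = w')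
    (h : HEq (φ.nat.app (Discrete.mk L.one)) (φ'.nat.app (Discrete.mk L.one))) : HEq φ φ' := by
  subst hy hw
  exact heq_of_eq (GNatTrans.ext_one (eq_of_heq h))

/-- The `G`-functor on an orbit determined by a fixed object. -/
def fixedObj (L : Orb G) (a : A.V) (ha : ∀ l ∈ L.sub, (act A l).obj a = a) :
    GFun (discObj L) A where
  hom := (Discrete.functor fun c : L.Coset => Quotient.liftOn' c (fun g => (act A g).obj a)
    fun g g' h => by
      have h' := ha _ (QuotientGroup.leftRel_apply.mp h)
      rw [← mul_inv_cancel_left g g', act_obj_mul, h']).toCatHom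
  comm g := by
    refine Cat.ext (functor_hext_of_discrete fun c => ?_)
    induction c using Quotient.inductionOn' with
    | h g' => exact act_obj_mul A g g' a

lemma fixedObj_one (a : A.V) (ha : ∀ l ∈ L.sub, (act A l).obj a = a) :
    (fixedObj L a ha).functor.obj (Discrete.mk L.one) = a :=
  act_obj_one A a

/-- The component at the coset gL has to be g · f, and it is well defined because `f` is `L`-fixed.
Heterogeneous equality absorbs the identifications of sources and targets. -/
lemma exists_fixedHom (y y' : GFun (discObj L) A)
    (f : y.functor.obj (Discrete.mk L.one) ⟶ y'.functor.obj (Discrete.mk L.one))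
    (hf : ∀ l ∈ L.sub, HEq ((act A l).map f) f) :
    ∃ φ : GNatTrans y y', φ.nat.app (Discrete.mk L.one) = f := by
  -- The component is compared with every representative of the coset, not only with a chosen one,
  -- so that equivariance can later be read off using the representative `g * g'`.
  have hex : ∀ c : L.Coset, ∃ k : y.functor.obj (Discrete.mk c) ⟶ y'.functor.obj (Discrete.mk c),
      ∀ g : G, ((g : G ⧸ L.sub) : L.Coset) = c → HEq k ((act A g).map f) := by
    intro c
    induction c using Quotient.inductionOn' with
    | h g =>
      refine ⟨eqToHom (y.obj_coset g) ≫ (act A g).map f ≫ eqToHom (y'.obj_coset g).symm, ?_⟩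
      intro g' hg'
      have hl : g'⁻¹ * g ∈ L.sub := QuotientGroup.eq.1 hg'
      have h1 : HEq ((act A g).map f) ((act A g').map f) := by
        have h2 := act_map_mul A g' (g'⁻¹ * g) f
        rw [mul_inv_cancel_left] at h2
        refine h2.trans (functor_map_heq _ ?_ ?_ (hf _ hl))
        · have := y.obj_act (g'⁻¹ * g) (Discrete.mk L.one)
          refine this.trans ?_
          change y.functor.obj (Discrete.mk ((g'⁻¹ * g) • L.one)) = _
          rw [smul_one_of_mem hl]
        · have := y'.obj_act (g'⁻¹ * g) (Discrete.mk L.one)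
          refine this.trans ?_
          change y'.functor.obj (Discrete.mk ((g'⁻¹ * g) • L.one)) = _
          rw [smul_one_of_mem hl]
      refine HEq.trans ?_ h1
      simp
  choose k hk using hex
  let nat : y.functor ⟶ y'.functor := Discrete.natTrans fun c => k c.as
  refine ⟨⟨nat, fun g c => ?_⟩, eq_of_heq ((hk L.one 1 rfl).trans (act_map_one A f))⟩
  obtain ⟨c⟩ := c
  induction c using Quotient.inductionOn' with
  | h g' =>
    have h1 : HEq ((act A g).map (k (g' : G ⧸ L.sub))) ((act A g).map ((act A g').map f)) :=
      functor_map_heq _ (y.obj_coset g') (y'.obj_coset g') (hk _ g' rfl)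
    exact h1.trans ((act_map_mul A g g' f).symm.trans (hk _ (g * g') rfl).symm)

/-- A functor with `L`-fixed values lifts to the category of `G`-functors out of `G/L`. -/
lemma exists_lift_evalOne {J : Type*} [Category* J] (F : J ⥤ A.V)
    (hF : ∀ l ∈ L.sub, F ⋙ act A l = F) :
    ∃ F' : J ⥤ ((fixedPts G).obj A).obj (op L), F' ⋙ evalOne A L = F := by
  have ho : ∀ j, ∃ y : GFun (discObj L) A, y.functor.obj (Discrete.mk L.one) = F.obj j :=
    fun j => ⟨fixedObj L (F.obj j) fun l hl => Functor.congr_obj (hF l hl) j, fixedObj_one _ _⟩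
  choose o ho using ho
  have hm : ∀ {i j : J} (f : i ⟶ j), ∃ φ : GNatTrans (o i) (o j),
      HEq (φ.nat.app (Discrete.mk L.one)) (F.map f) := by
    intro i j f
    have hk : HEq (eqToHom (ho i) ≫ F.map f ≫ eqToHom (ho j).symm) (F.map f) := by simp
    obtain ⟨φ, hφ⟩ := exists_fixedHom (o i) (o j) (eqToHom (ho i) ≫ F.map f ≫ eqToHom (ho j).symm)
      fun l hl => (functor_map_heq _ (ho i) (ho j) hk).trans
        ((Functor.hcongr_hom (hF l hl) f).trans hk.symm)
    exact ⟨φ, by rw [hφ]; exact hk⟩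
  choose m hm using @hm
  refine ⟨⟨o, fun f => m f, fun j => ?_, fun {i j k} f g => ?_⟩, ?_⟩
  · refine GNatTrans.ext_one (eq_of_heq ((hm _).trans ?_))
    rw [F.map_id]
    exact heq_id (ho j).symm
  · refine GNatTrans.ext_one (eq_of_heq ((hm _).trans ?_))
    rw [F.map_comp]
    exact heq_comp (ho i).symm (ho j).symm (ho k).symm (hm f).symm (hm g).symm
  · exact Functor.hext ho fun i j f => hm f

lemma comp_evalOne_injective {J : Type*} [Category* J]
    {F F' : J ⥤ ((fixedPts G).obj A).obj (op L)} (h : F ⋙ evalOne A L = F' ⋙ evalOne A L) :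
    F = F' := by
  have ho : ∀ j, F.obj j = F'.obj j := fun j => GFun.ext_one (Functor.congr_obj h j)
  exact Functor.hext ho fun i j f => GNatTrans.hext_one (ho i) (ho j) (Functor.hcongr_hom h f)

lemma evalOne_comp_act {l : G} (hl : l ∈ L.sub) : evalOne A L ⋙ act A l = evalOne A L := by
  have h1 : ∀ y : GFun (discObj L) A, (act A l).obj (y.functor.obj (Discrete.mk L.one))
      = y.functor.obj (Discrete.mk L.one) := fun y => by
    have := y.obj_act l (Discrete.mk L.one)
    refine this.trans ?_
    change y.functor.obj (Discrete.mk (l • L.one)) = _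
    rw [smul_one_of_mem hl]
  refine Functor.hext h1 fun y y' φ => ?_
  refine (GNatTrans.equivariant φ l (Discrete.mk L.one)).trans ?_
  change HEq (φ.nat.app (Discrete.mk (l • L.one))) (φ.nat.app (Discrete.mk L.one))
  rw [smul_one_of_mem hl]

/-! ## Fixed points of classifying spaces -/

lemma levelwiseInjective_evalOne (A : Action Cat.{u, u} G) (L : Orb G) :
    LevelwiseInjective (nerveMap (evalOne A L)) :=
  fun _ _ _ h => comp_evalOne_injective h

lemma levelwiseInjective_act (A : Action Cat.{u, u} G) (g : G) :
    LevelwiseInjective (nerveMap (act A g)) := by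
  intro n
  refine Function.LeftInverse.injective (g := (nerveMap (act A g⁻¹)).app (op n)) fun σ => ?_
  change (show ComposableArrows A.V n.len from σ) ⋙ (act A g ⋙ act A g⁻¹) = σ
  rw [← act_mul, inv_mul_cancel, act_one]
  rfl

/-- An n-simplex of the nerve is a functor out of a finite ordinal. It is fixed by `L` exactly when
it lifts along `evalOne`, so the criterion for realizations of fixed simplices applies. -/
lemma range_toTop_evalOne (A : Action Cat.{u, u} G) (L : Orb G)
    (p : SSet.toTop.obj (nerve A.V)) :
    (∃ q, SSet.toTop.map (nerveMap (evalOne A L)) q = p) ↔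
      ∀ l : L.sub, SSet.toTop.map (nerveMap (act A l.1)) p = p := by
  refine mem_range_toTop_map_iff (fun l : L.sub => nerveMap (act A l.1)) (fun l => levelwiseInjective_act A l.1) (fun n σ => ?_) p
  constructor
  · rintro ⟨y, rfl⟩ l
    exact congrArg (fun K => (show ComposableArrows _ n.len from y) ⋙ K) (evalOne_comp_act l.2)
  · intro h
    exact exists_lift_evalOne (show ComposableArrows A.V n.len from σ) fun l hl => h ⟨l, hl⟩

/-- The `L`-fixed points of the classifying space of a `G`-category are the classifying space of
the category of `L`-fixed points. -/
noncomputable def fixedSpaceHomeo (A : Action Cat.{u, u} G) (L : Orb G) :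
    classifyingSpace.obj (((fixedPts G).obj A).obj (op L)) ≃ₜ
      FixedSpace ((classifyingSpace.mapAction G).obj A) L.sub :=
  (levelwiseInjective_evalOne A L).isClosedEmbedding.isEmbedding.toHomeomorph.trans
    (Homeomorph.setCongr (t := {x | ∀ h ∈ L.sub,
      spaceAct ((classifyingSpace.mapAction G).obj A) h x = x}) (Set.ext fun p =>
        (range_toTop_evalOne A L p).trans ⟨fun h l hl => h ⟨l, hl⟩, fun h (l : L.sub) => h l.1 l.2⟩))

/-- On underlying points the homeomorphism is B of `evalOne`, so the square comes from the strict
commutation of evaluation at eL with postcomposition. -/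
lemma fixedSpaceHomeo_naturality {A B : Action Cat.{u, u} G} (F : A ⟶ B) (L : Orb G)
    (x : classifyingSpace.obj (((fixedPts G).obj A).obj (op L))) :
    fixedSpaceHomeo B L ((classifyingSpace.map (((fixedPts G).map F).app (op L))).hom x) =
      fixedMap ((classifyingSpace.mapAction G).map F) L.sub (fixedSpaceHomeo A L x) := by
  refine Subtype.ext ?_
  have h : ((fixedPts G).map F).app (op L) ≫ (evalOne B L).toCatHom =
      (evalOne A L).toCatHom ≫ F.hom := rfl
  have h2 := (classifyingSpace.map_comp (((fixedPts G).map F).app (op L))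
    (evalOne B L).toCatHom).symm.trans ((congrArg (fun k => classifyingSpace.map k) h).trans
      (classifyingSpace.map_comp (evalOne A L).toCatHom F.hom))
  exact congrArg (fun k => k.hom x) h2

end FixedPoints
end Elmendorf

namespace Elmendorf

section Counit

/-! ## The counit `ε` -/

variable {G : Type u} [Group G]

lemma Orb.hom_ext_one {L H : Orb G} {r r' : L ⟶ H} (h : Orb.gmap r L.one = Orb.gmap r' L.one) :
    r = r' := by
  refine MulActionHom.ext fun c => ?_
  induction c using Quotient.inductionOn' with
  | h g =>
    change Orb.gmap r ((g : G ⧸ L.sub) : L.Coset) = Orb.gmap r' ((g : G ⧸ L.sub) : L.Coset)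
    rw [coset_eq_smul_one, map_smul, map_smul, h]

variable {X Y : OrbPsh G} {L L' : Orb G}

/-- Restriction of the element of a triple along a map of orbits. -/
abbrev Elm.restrict (z : Elm X) (r : L ⟶ z.orb) : X.obj (op L) :=
  (X.map r.op).toFunctor.obj z.elt

/-- Maps out of G/L are determined by the image of eL, so equal triples have matching restriction
maps and no transport of `r` has to be tracked. -/
lemma Elm.restrict_congr {z z' : Elm X} (h : z = z') {r : L ⟶ z.orb} {r' : L ⟶ z'.orb}
    (hr : Orb.gmap r L.one = z.pt) (hr' : Orb.gmap r' L.one = z'.pt) :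
    z.restrict r = z'.restrict r' := by
  subst h
  rw [Orb.hom_ext_one (hr.trans hr'.symm)]

lemma Elm.restrict_hom_congr {z z' w w' : Elm X} (hz : z = z') (hw : w = w') {φ : z ⟶ w}
    {φ' : z' ⟶ w'} (hφ : HEq φ φ') {s : L ⟶ w.orb} {s' : L ⟶ w'.orb}
    (hs : Orb.gmap s L.one = w.pt) (hs' : Orb.gmap s' L.one = w'.pt) :
    HEq ((X.map s.op).toFunctor.map (Elm.homElt φ))
      ((X.map s'.op).toFunctor.map (Elm.homElt φ')) := by
  subst hz hw
  cases hφ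
  rw [Orb.hom_ext_one (hs.trans hs'.symm)]

lemma psh_map_comp_obj (X : OrbPsh G) {H K M : Orb G} (f : H ⟶ K) (g : K ⟶ M)
    (x : X.obj (op M)) :
    (X.map (f ≫ g).op).toFunctor.obj x
      = (X.map f.op).toFunctor.obj ((X.map g.op).toFunctor.obj x) :=
  Functor.congr_obj (congrArg Cat.Hom.toFunctor (X.map_comp g.op f.op)) x

lemma psh_map_comp_map (X : OrbPsh G) {H K M : Orb G} (f : H ⟶ K) (g : K ⟶ M)
    {x y : X.obj (op M)} (k : x ⟶ y) :
    HEq ((X.map (f ≫ g).op).toFunctor.map k)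
      ((X.map f.op).toFunctor.map ((X.map g.op).toFunctor.map k)) :=
  Functor.hcongr_hom (congrArg Cat.Hom.toFunctor (X.map_comp g.op f.op)) k

lemma psh_map_id_obj (X : OrbPsh G) {H : Orb G} (x : X.obj (op H)) :
    (X.map (𝟙 H : H ⟶ H).op).toFunctor.obj x = x :=
  Functor.congr_obj (congrArg Cat.Hom.toFunctor (X.map_id (op H))) x

lemma psh_map_id_map (X : OrbPsh G) {H : Orb G} {x y : X.obj (op H)} (k : x ⟶ y) :
    HEq ((X.map (𝟙 H : H ⟶ H).op).toFunctor.map k) k :=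
  Functor.hcongr_hom (congrArg Cat.Hom.toFunctor (X.map_id (op H))) k

/-- Both maps carry eL to aH: r_b sends eL to bK, and f sends bK to aH. This equality makes r_b^*
f^* x and r_a^* x the same object. -/
lemma rMap_comp {y y' : ((fixedPts G).obj ((elm G).obj X)).obj (op L)} (φ : y ⟶ y') :
    rMap y' ≫ Elm.homMap (tripleHom φ) = rMap y := by
  refine Orb.hom_ext_one ?_
  refine Eq.trans ?_ (rMap_one y).symm
  change Orb.gmap (Elm.homMap (tripleHom φ)) (Orb.gmap (rMap y') L.one) = _
  rw [rMap_one]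
  exact (Grothendieck.Hom.base (tripleHom φ)).unop.2

lemma eqToHom_comp_heq' {C : Type*} [Category* C] {x y z : C} (h : x = y) (f : y ⟶ z) :
    HEq (eqToHom h ≫ f) f := by
  subst h
  exact heq_of_eq (Category.id_comp f)

lemma functor_map_eqToHom_comp_heq {C D : Type*} [Category* C] [Category* D] (F : C ⥤ D)
    {x y z : C} (h : x = y) (f : y ⟶ z) : HEq (F.map (eqToHom h ≫ f)) (F.map f) := by
  subst h
  exact heq_of_eq (congrArg F.map (Category.id_comp f))

/-- Restriction of a morphism of triples along compatible maps of orbits. -/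
def Elm.restrictMap {z w : Elm X} (φ : z ⟶ w) (r : L ⟶ z.orb) (s : L ⟶ w.orb)
    (h : s ≫ Elm.homMap φ = r) : z.restrict r ⟶ w.restrict s :=
  eqToHom (by rw [← psh_map_comp_obj, h]) ≫ (X.map s.op).toFunctor.map (Elm.homElt φ)

lemma Elm.restrictMap_heq {z w : Elm X} (φ : z ⟶ w) (r : L ⟶ z.orb) (s : L ⟶ w.orb)
    (h : s ≫ Elm.homMap φ = r) :
    HEq (Elm.restrictMap φ r s h) ((X.map s.op).toFunctor.map (Elm.homElt φ)) :=
  eqToHom_comp_heq' _ _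

lemma Elm.homElt_id_heq (z : Elm X) : HEq (Elm.homElt (𝟙 z)) (𝟙 z.elt) :=
  eqToHom_heq_id_cod _ _ (psh_map_id_obj X z.elt)

lemma Elm.homElt_comp_heq {z w v : Elm X} (φ : z ⟶ w) (ψ : w ⟶ v) :
    HEq (Elm.homElt (φ ≫ ψ))
      ((X.map (Elm.homMap ψ).op).toFunctor.map (Elm.homElt φ) ≫ Elm.homElt ψ) :=
  eqToHom_comp_heq' _ _

lemma Elm.restrictMap_id (z : Elm X) (r : L ⟶ z.orb) (h : r ≫ Elm.homMap (𝟙 z) = r) :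
    Elm.restrictMap (𝟙 z) r r h = 𝟙 _ := by
  refine eq_of_heq ((Elm.restrictMap_heq _ _ _ _).trans ?_)
  refine (functor_map_heq (X.map r.op).toFunctor (psh_map_id_obj X z.elt) rfl
    (Elm.homElt_id_heq z)).trans ?_
  exact heq_of_eq ((X.map r.op).toFunctor.map_id _)

lemma Elm.restrictMap_comp {z w v : Elm X} (φ : z ⟶ w) (ψ : w ⟶ v) (r : L ⟶ z.orb)
    (s : L ⟶ w.orb) (q : L ⟶ v.orb) (h : s ≫ Elm.homMap φ = r) (h' : q ≫ Elm.homMap ψ = s)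
    (h'' : q ≫ Elm.homMap (φ ≫ ψ) = r) :
    Elm.restrictMap (φ ≫ ψ) r q h'' = Elm.restrictMap φ r s h ≫ Elm.restrictMap ψ s q h' := by
  subst h'
  subst h
  refine eq_of_heq ((Elm.restrictMap_heq _ _ _ _).trans ?_)
  refine (functor_map_heq (X.map q.op).toFunctor (psh_map_comp_obj X _ _ _) rfl
    (Elm.homElt_comp_heq φ ψ)).trans ?_
  refine (heq_of_eq ((X.map q.op).toFunctor.map_comp _ _)).trans ?_
  refine heq_comp ?_ (psh_map_comp_obj X _ _ _).symm rfl ?_ (Elm.restrictMap_heq _ _ _ _).symm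
  · refine ((psh_map_comp_obj X _ _ _).trans (psh_map_comp_obj X _ _ _)).symm
  · exact ((Elm.restrictMap_heq _ _ _ _).trans (psh_map_comp_map X _ _ _)).symm

/-- The component of the counit at an orbit. -/
def counitAt (X : OrbPsh G) (L : Orb G) :
    ((fixedPts G).obj ((elm G).obj X)).obj (op L) ⥤ X.obj (op L) where
  obj y := (triple y).restrict (rMap y)
  map φ := Elm.restrictMap (tripleHom φ) _ _ (rMap_comp φ)
  map_id y := Elm.restrictMap_id (triple y) (rMap y) (rMap_comp (𝟙 y))
  map_comp φ ψ := Elm.restrictMap_comp (tripleHom φ) (tripleHom ψ) _ _ _ (rMap_comp φ)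
    (rMap_comp ψ) (rMap_comp (φ ≫ ψ))

lemma counitAt_map_heq {y y' : ((fixedPts G).obj ((elm G).obj X)).obj (op L)} (φ : y ⟶ y') :
    HEq ((counitAt X L).map φ)
      ((X.map (rMap y').op).toFunctor.map (Elm.homElt (tripleHom φ))) :=
  Elm.restrictMap_heq _ _ _ (rMap_comp φ)

section Restriction

variable (p : L' ⟶ L) {g : G} (hg : ((g : G ⧸ L.sub) : L.Coset) = Orb.gmap p L'.one)

/-- Restriction in the presheaf `Φ C X`. -/
abbrev fixedRestrict (X : OrbPsh G) (p : L' ⟶ L) :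
    ((fixedPts G).obj ((elm G).obj X)).obj (op L) ⥤ ((fixedPts G).obj ((elm G).obj X)).obj (op L') :=
  (((fixedPts G).obj ((elm G).obj X)).map p.op).toFunctor

include hg

lemma triple_fixedRestrict (y : ((fixedPts G).obj ((elm G).obj X)).obj (op L)) :
    triple ((fixedRestrict X p).obj y) = (Elm.smul X g).obj (triple y) := by
  have h := GFun.obj_coset (A := elmObj X) (L := L) y g
  rw [hg] at h
  exact h

lemma tripleHom_fixedRestrict {y y' : ((fixedPts G).obj ((elm G).obj X)).obj (op L)}
    (φ : y ⟶ y') :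
    HEq (tripleHom ((fixedRestrict X p).map φ)) ((Elm.smul X g).map (tripleHom φ)) := by
  have h := GNatTrans.app_coset (A := elmObj X) (L := L) φ g
  rw [hg] at h
  exact h

lemma comp_rMap_one (y : ((fixedPts G).obj ((elm G).obj X)).obj (op L)) :
    Orb.gmap (p ≫ rMap y) L'.one = ((Elm.smul X g).obj (triple y)).pt := by
  change Orb.gmap (rMap y) (Orb.gmap p L'.one) = g • (triple y).pt
  rw [← hg, coset_eq_smul_one, map_smul, rMap_one]

end Restriction

/-- If p(eL') = gL, restriction along p turns the triple (G/H, aH, x) into (G/H, gaH, x). The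
composite r_a ∘ p also carries eL' to gaH, so it is the map attached to the restricted triple. -/
lemma fixedRestrict_comp_counitAt (X : OrbPsh G) (p : L' ⟶ L) :
    fixedRestrict X p ⋙ counitAt X L' = counitAt X L ⋙ (X.map p.op).toFunctor := by
  obtain ⟨g, hg⟩ : ∃ g : G, ((g : G ⧸ L.sub) : L.Coset) = Orb.gmap p L'.one :=
    QuotientGroup.mk_surjective _
  refine Functor.hext (fun y => ?_) fun y y' φ => ?_
  · refine (Elm.restrict_congr (triple_fixedRestrict p hg y) (rMap_one _)
      (comp_rMap_one p hg y)).trans ?_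
    exact psh_map_comp_obj X p (rMap y) _
  · refine (counitAt_map_heq _).trans ((Elm.restrict_hom_congr (triple_fixedRestrict p hg y)
      (triple_fixedRestrict p hg y') (tripleHom_fixedRestrict p hg φ) (rMap_one _)
      (comp_rMap_one p hg y')).trans ?_)
    refine (psh_map_comp_map X p (rMap y') _).trans ?_
    exact (functor_map_eqToHom_comp_heq (X.map p.op).toFunctor _ _).symm

/-- The counit at a presheaf. -/
def counitApp (X : OrbPsh G) : (fixedPts G).obj ((elm G).obj X) ⟶ X where
  app U := (counitAt X U.unop).toCatHom
  naturality _ _ p := Cat.ext (fixedRestrict_comp_counitAt X p.unop)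

lemma Elm.homElt_map_heq (t : X ⟶ Y) {z w : Elm X} (φ : z ⟶ w) :
    HEq (Elm.homElt ((Grothendieck.map (Functor.whiskerLeft (forgetPt G).op t)).map φ))
      ((t.app (op w.orb)).toFunctor.map (Elm.homElt φ)) := by
  have key : ∀ {C D : Cat.{u, u}} {P Q : C ⟶ D} (h : P = Q) (x : C) {v : D}
      (f : Q.toFunctor.obj x ⟶ v), HEq ((eqToHom h).toNatTrans.app x ≫ f) f := by
    intro C D P Q h x v f
    subst h
    exact heq_of_eq (Category.id_comp f)
  exact key _ _ _

/-- The map r_a depends only on the pointed orbit, which `t` leaves unchanged; the rest is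
naturality of `t` along r_a. -/
lemma map_comp_counitAt (t : X ⟶ Y) (L : Orb G) :
    (((fixedPts G).map ((elm G).map t)).app (op L)).toFunctor ⋙ counitAt Y L
      = counitAt X L ⋙ (t.app (op L)).toFunctor := by
  have ho : ∀ {H : Orb G} (r : L ⟶ H) (x : X.obj (op H)),
      (Y.map r.op).toFunctor.obj ((t.app (op H)).toFunctor.obj x)
        = (t.app (op L)).toFunctor.obj ((X.map r.op).toFunctor.obj x) := fun r x =>
    (Functor.congr_obj (congrArg Cat.Hom.toFunctor (t.naturality r.op)) x).symm
  have hm : ∀ {H : Orb G} (r : L ⟶ H) {x x' : X.obj (op H)} (k : x ⟶ x'),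
      HEq ((Y.map r.op).toFunctor.map ((t.app (op H)).toFunctor.map k))
        ((t.app (op L)).toFunctor.map ((X.map r.op).toFunctor.map k)) := fun r _ _ k =>
    (Functor.hcongr_hom (congrArg Cat.Hom.toFunctor (t.naturality r.op)) k).symm
  refine Functor.hext (fun y => ho (rMap y) (triple y).elt) fun y y' φ => ?_
  refine (counitAt_map_heq _).trans ?_
  refine HEq.trans ?_ (functor_map_eqToHom_comp_heq (t.app (op L)).toFunctor _ _).symm
  refine HEq.trans ?_ (hm (rMap y') (Elm.homElt (tripleHom φ)))
  refine functor_map_heq (Y.map (rMap y').op).toFunctor ?_ rfl (Elm.homElt_map_heq t (tripleHom φ))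
  exact (Functor.congr_obj (congrArg Cat.Hom.toFunctor (t.naturality
    (Elm.homMap (tripleHom φ)).op)) (triple y).elt).symm

variable (G) in
/-- The counit `Φ C ⇒ id`. -/
def counit : elm G ⋙ fixedPts G ⟶ 𝟭 (OrbPsh G) where
  app := counitApp
  naturality _ _ t := NatTrans.ext (funext fun U => Cat.ext (map_comp_counitAt t U.unop))

end Counit
end Elmendorf

namespace Elmendorf

section Unit

/-! ## The homotopy inverse of the counit at an orbit -/

variable {G : Type u} [Group G] (X : OrbPsh G) (L : Orb G)

/-- The inclusion `x ↦ (G/L, c, x)` of the fibre over a pointed orbit. -/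
abbrev fiberIncl (c : L.Coset) : X.obj (op L) ⥤ Elm X :=
  Grothendieck.ι ((forgetPt G).op ⋙ X) (op ⟨L, c⟩)

/-- The `G`-functor `c ↦ (G/L, c, x)`. -/
def unitObj (x : X.obj (op L)) : GFun (discObj L) (elmObj X) where
  hom := (Discrete.functor fun c : L.Coset => (fiberIncl X L c).obj x).toCatHom
  comm _ := Cat.ext (functor_hext_of_discrete fun _ => rfl)

/-- The functor `η : X(G/L) ⥤ (CX)^L`, `x ↦ (G/L, eL, x)`. -/
def unitAt : X.obj (op L) ⥤ ((fixedPts G).obj ((elm G).obj X)).obj (op L) where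
  obj x := unitObj X L x
  map f :=
    { nat := Discrete.natTrans fun c => (fiberIncl X L c.as).map f
      equivariant := fun _ _ => HEq.rfl }
  map_id x := GNatTrans.ext_one ((fiberIncl X L L.one).map_id x)
  map_comp f f' := GNatTrans.ext_one ((fiberIncl X L L.one).map_comp f f')

lemma unitAt_comp_evalOne :
    unitAt X L ⋙ evalOne ((elm G).obj X) L = fiberIncl X L L.one := rfl

variable {X L}

lemma rMap_unitAt (x : X.obj (op L)) : rMap ((unitAt X L).obj x) = 𝟙 L :=
  Orb.hom_ext_one (rMap_one _)

lemma homElt_fiberIncl_heq (c : L.Coset) {x x' : X.obj (op L)} (f : x ⟶ x') :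
    HEq (Elm.homElt ((fiberIncl X L c).map f)) f :=
  eqToHom_comp_heq' _ _

lemma unitAt_comp_counitAt : unitAt X L ⋙ counitAt X L = 𝟭 _ := by
  have ho : ∀ x, (X.map (rMap ((unitAt X L).obj x)).op).toFunctor.obj x = x := fun x => by
    rw [rMap_unitAt]
    exact psh_map_id_obj X x
  refine Functor.hext ho fun x x' f => ?_
  refine (counitAt_map_heq _).trans ?_
  refine (functor_map_heq _ (psh_map_id_obj X x) rfl (homElt_fiberIncl_heq L.one f)).trans ?_
  rw [rMap_unitAt]
  exact psh_map_id_map X f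

/-- The morphism `(r_a, id) : (G/H, aH, x) ⟶ (G/L, eL, r_a^* x)`. -/
abbrev retractHom (y : ((fixedPts G).obj ((elm G).obj X)).obj (op L)) :
    triple y ⟶ triple ((unitAt X L).obj ((counitAt X L).obj y)) :=
  Elm.homMk (X := X) (rMap y) (rMap_one y) (𝟙 ((X.map (rMap y).op).toFunctor.obj (triple y).elt))

/-- The action leaves the pair (r_a, id) unchanged and moves only the marked cosets; both aH and eL
are `L`-fixed, so the morphism is `L`-fixed. -/
lemma exists_retract (y : ((fixedPts G).obj ((elm G).obj X)).obj (op L)) :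
    ∃ φ : y ⟶ (unitAt X L).obj ((counitAt X L).obj y), tripleHom φ = retractHom y := by
  refine exists_fixedHom (A := elmObj X) (L := L) y (unitObj X L _) (retractHom y) fun l hl => ?_
  exact Elm.homMk_heq _ _ _ _ (pt_fixed y l hl) (smul_one_of_mem hl)

lemma Elm.hom_hext {z w : Elm X} {φ ψ : z ⟶ w} (h : Elm.homMap φ = Elm.homMap ψ)
    (h' : HEq (Elm.homElt φ) (Elm.homElt ψ)) : φ = ψ := by
  have hb : Grothendieck.Hom.base φ = Grothendieck.Hom.base ψ :=
    Quiver.Hom.unop_inj (Subtype.ext h)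
  exact Grothendieck.ext φ ψ hb (eq_of_heq ((eqToHom_comp_heq' _ _).trans h'))

/-- Both composites have orbit map r_a and second component ε(φ). -/
lemma retractHom_naturality {y y' : ((fixedPts G).obj ((elm G).obj X)).obj (op L)} (φ : y ⟶ y') :
    tripleHom φ ≫ retractHom y' =
      retractHom y ≫ tripleHom ((unitAt X L).map ((counitAt X L).map φ)) := by
  refine Elm.hom_hext (rMap_comp φ) ?_
  refine (Elm.homElt_comp_heq _ _).trans (HEq.trans ?_ (Elm.homElt_comp_heq _ _).symm)
  have h1 : HEq ((X.map (rMap y').op).toFunctor.map (Elm.homElt (tripleHom φ)))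
      ((counitAt X L).map φ) := (counitAt_map_heq φ).symm
  have h2 : HEq (Elm.homElt (tripleHom ((unitAt X L).map ((counitAt X L).map φ))))
      ((counitAt X L).map φ) := homElt_fiberIncl_heq L.one _
  have e1 := (X.map (𝟙 L : L ⟶ L).op).toFunctor.map_id ((counitAt X L).obj y)
  have h3 : HEq ((X.map (𝟙 L : L ⟶ L).op).toFunctor.map (𝟙 ((counitAt X L).obj y)) ≫
      Elm.homElt (tripleHom ((unitAt X L).map ((counitAt X L).map φ)))) ((counitAt X L).map φ) := by
    rw [e1]
    exact (heq_of_eq (Category.id_comp _)).trans h2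
  exact ((heq_of_eq (Category.comp_id _)).trans h1).trans h3.symm

variable (X L) in
/-- The natural transformation `id ⇒ η ∘ ε` with components `(r_a, id)`. -/
noncomputable def retractNat : 𝟭 _ ⟶ counitAt X L ⋙ unitAt X L where
  app y := (exists_retract y).choose
  naturality y y' φ := by
    refine GNatTrans.ext_one ?_
    change tripleHom φ ≫ tripleHom (exists_retract y').choose =
      tripleHom (exists_retract y).choose ≫ tripleHom ((unitAt X L).map ((counitAt X L).map φ))
    rw [(exists_retract y).choose_spec, (exists_retract y').choose_spec]
    exact retractHom_naturality φ

lemma tripleHom_retractNat (y : ((fixedPts G).obj ((elm G).obj X)).obj (op L)) :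
    tripleHom ((retractNat X L).app y) = retractHom y :=
  (exists_retract y).choose_spec

/-- The marked coset of the target is eL, whose map is the identity of G/L, so ε(r_a, id) is an
identity. This is the condition that makes the homotopy of classifying spaces fibrewise. -/
lemma counitAt_map_retractNat (y : ((fixedPts G).obj ((elm G).obj X)).obj (op L)) :
    HEq ((counitAt X L).map ((retractNat X L).app y)) (𝟙 ((counitAt X L).obj y)) := by
  refine (counitAt_map_heq _).trans ?_
  rw [tripleHom_retractNat]
  refine (heq_of_eq ((X.map (rMap ((unitAt X L).obj ((counitAt X L).obj y))).op).toFunctor.map_id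
    ((counitAt X L).obj y))).trans (heq_id ?_)
  exact Functor.congr_obj unitAt_comp_counitAt ((counitAt X L).obj y)

/-- The counit is a fibrewise retraction of classifying spaces at each orbit. -/
noncomputable def counitRetract (X : OrbPsh G) (L : Orb G) :
    FiberwiseRetract (classifyingSpace.map (counitAt X L).toCatHom).hom :=
  classifyingRetract (counitAt X L).toCatHom (unitAt X L).toCatHom
    (Cat.ext unitAt_comp_counitAt) (retractNat X L) counitAt_map_retractNat

end Unit

section Evaluation

/-! ## The evaluation `ev` -/

variable {G : Type u} [Group G]

/-- Evaluation `Fun^G(G/L, A) ⥤ A` at a coset. -/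
def evalAt (A : Action Cat.{u, u} G) (L : Orb G) (c : L.Coset) :
    ((fixedPts G).obj A).obj (op L) ⥤ A.V where
  obj y := (show GFun (discObj L) A from y).functor.obj (Discrete.mk c)
  map {y y'} φ := (show GNatTrans (A := discObj L) (B := A) y y' from φ).nat.app (Discrete.mk c)
  map_id _ := rfl
  map_comp _ _ := rfl

lemma evalAt_map_heq (A : Action Cat.{u, u} G) {L : Orb G} {c c' : L.Coset} (h : c = c')
    {y y' : ((fixedPts G).obj A).obj (op L)} (φ : y ⟶ y') :
    HEq ((evalAt A L c).map φ) ((evalAt A L c').map φ) := by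
  subst h
  rfl

lemma evalAt_act_obj (A : Action Cat.{u, u} G) {L : Orb G} (c : L.Coset) (g : G)
    (y : ((fixedPts G).obj A).obj (op L)) :
    (evalAt A L (g • c)).obj y = (act A g).obj ((evalAt A L c).obj y) :=
  (GFun.obj_act (A := discObj L) (B := A) y g (Discrete.mk c)).symm

lemma evalAt_act_map (A : Action Cat.{u, u} G) {L : Orb G} (c : L.Coset) (g : G)
    {y y' : ((fixedPts G).obj A).obj (op L)} (φ : y ⟶ y') :
    HEq ((evalAt A L (g • c)).map φ) ((act A g).map ((evalAt A L c).map φ)) :=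
  (GNatTrans.equivariant (A := discObj L) (B := A) φ g (Discrete.mk c)).symm

lemma Elm.homMap_pt {X : OrbPsh G} {z w : Elm X} (φ : z ⟶ w) :
    Orb.gmap (Elm.homMap φ) w.pt = z.pt :=
  (Grothendieck.Hom.base φ).unop.2

/-- The action of evaluation on a morphism of triples. -/
def evalMap {A : Action Cat.{u, u} G} {z w : Elm ((fixedPts G).obj A)} (φ : z ⟶ w) :
    (evalAt A z.orb z.pt).obj z.elt ⟶ (evalAt A w.orb w.pt).obj w.elt :=
  eqToHom (by rw [← Elm.homMap_pt φ]; rfl) ≫ (evalAt A w.orb w.pt).map (Elm.homElt φ)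

lemma evalMap_heq {A : Action Cat.{u, u} G} {z w : Elm ((fixedPts G).obj A)} (φ : z ⟶ w) :
    HEq (evalMap φ) ((evalAt A w.orb w.pt).map (Elm.homElt φ)) :=
  eqToHom_comp_heq' _ _

/-- The evaluation functor `(G/H, aH, x) ↦ x(aH)`. -/
def evalFunctor (A : Action Cat.{u, u} G) : Elm ((fixedPts G).obj A) ⥤ A.V where
  obj z := (evalAt A z.orb z.pt).obj z.elt
  map φ := evalMap φ
  map_id z := by
    refine eq_of_heq ((evalMap_heq _).trans ?_)
    refine (functor_map_heq (evalAt A z.orb z.pt) (psh_map_id_obj _ z.elt) rfl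
      (Elm.homElt_id_heq z)).trans ?_
    exact heq_of_eq ((evalAt A z.orb z.pt).map_id _)
  map_comp {z w v} φ ψ := by
    refine eq_of_heq ((evalMap_heq _).trans ?_)
    refine (functor_map_heq (evalAt A v.orb v.pt) (psh_map_comp_obj _ _ _ _) rfl
      (Elm.homElt_comp_heq φ ψ)).trans ?_
    refine (heq_of_eq ((evalAt A v.orb v.pt).map_comp _ _)).trans ?_
    have h1 : ∀ y, (evalAt A w.orb w.pt).obj y =
        (evalAt A v.orb v.pt).obj ((((fixedPts G).obj A).map (Elm.homMap ψ).op).toFunctor.obj y) :=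
      fun y => by
        rw [← Elm.homMap_pt ψ]
        rfl
    refine heq_comp ?_ (h1 _).symm rfl ?_ (evalMap_heq ψ).symm
    · rw [← h1, ← Elm.homMap_pt φ]
      rfl
    · exact (evalAt_map_heq A (Elm.homMap_pt ψ) (Elm.homElt φ)).trans (evalMap_heq φ).symm

/-- The evaluation `G`-functor `C Φ A ⟶ A`. -/
def evalApp (A : Action Cat.{u, u} G) : elmObj ((fixedPts G).obj A) ⟶ A where
  hom := (evalFunctor A).toCatHom
  comm g := Cat.ext (Functor.hext (fun z => evalAt_act_obj A z.pt g z.elt) fun _ w φ =>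
    (evalMap_heq _).trans ((evalAt_act_map A w.pt g (Elm.homElt φ)).trans
      (functor_map_eqToHom_comp_heq (act A g) _ _).symm))

variable (G) in
/-- The natural transformation `C Φ ⇒ id`. -/
def evalNat : fixedPts G ⋙ elm G ⟶ 𝟭 (Action Cat.{u, u} G) where
  app := evalApp
  naturality A B F := Action.Hom.ext (Cat.ext (Functor.hext (fun _ => rfl) fun z w φ => by
    refine (evalMap_heq _).trans ?_
    refine HEq.trans ?_ (functor_map_eqToHom_comp_heq F.hom.toFunctor _ _).symm
    exact functor_map_heq (evalAt B w.orb w.pt) rfl rfl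
      (Elm.homElt_map_heq ((fixedPts G).map F) φ)))

/-- The functor is defined by evaluating x at the coset aH itself, which needs no representative;
equivariance of x rewrites the value as a · x(eH). -/
lemma evalApp_obj (A : Action Cat.{u, u} G) (H : Orb G) (a : G)
    (x : ((fixedPts G).obj A).obj (op H)) :
    (evalFunctor A).obj (Elm.mk (X := (fixedPts G).obj A) H (a : G ⧸ H.sub) x)
      = (act A a).obj ((evalOne A H).obj x) :=
  GFun.obj_coset (A := A) (L := H) x a

lemma evalApp_map (A : Action Cat.{u, u} G) (H K : Orb G) (a b : G)
    (x : ((fixedPts G).obj A).obj (op H)) (x' : ((fixedPts G).obj A).obj (op K))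
    (φ : Elm.mk (X := (fixedPts G).obj A) H (a : G ⧸ H.sub) x ⟶
      Elm.mk (X := (fixedPts G).obj A) K (b : G ⧸ K.sub) x') :
    HEq ((evalFunctor A).map φ) ((act A b).map ((evalOne A K).map (Elm.homElt φ))) :=
  (evalMap_heq φ).trans (GNatTrans.app_coset (A := A) (L := K) (Elm.homElt φ) b)

/-- `G`-functors on G/L are compared at eL, where one side is x(aH) and the other is (r_a^* x)(eL) =
x(r_a(eL)). -/
lemma fixedPts_map_evalApp (A : Action Cat.{u, u} G) :
    (fixedPts G).map (evalApp A) = counitApp ((fixedPts G).obj A) := by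
  refine NatTrans.ext (funext fun U => ?_)
  obtain ⟨L⟩ := U
  have h : ∀ y : ((fixedPts G).obj ((elm G).obj ((fixedPts G).obj A))).obj (op L),
      (((fixedPts G).map (evalApp A)).app (op L)).toFunctor.obj y
        = (counitAt ((fixedPts G).obj A) L).obj y := fun y => by
    refine GFun.ext_one ?_
    change (evalAt A (triple y).orb (triple y).pt).obj (triple y).elt =
      (evalAt A (triple y).orb (Orb.gmap (rMap y) L.one)).obj (triple y).elt
    rw [rMap_one]
  refine Cat.ext (Functor.hext h fun y y' φ => GNatTrans.hext_one (h y) (h y') ?_)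
  refine (evalMap_heq (tripleHom φ)).trans ?_
  refine HEq.trans ?_ (functor_map_eqToHom_comp_heq (evalOne A L) _ _).symm
  exact evalAt_map_heq A (rMap_one y').symm (Elm.homElt (tripleHom φ))

/-- Evaluation is a weak equivalence of `G`-categories. -/
lemma isWeakEquivGCat_evalApp (A : Action Cat.{u, u} G) : IsWeakEquivGCat (evalApp A) := by
  intro H
  have R := counitRetract ((fixedPts G).obj A) ⟨H⟩
  -- Under the fixed-point homeomorphisms the map B(ev)^H becomes B of the component of Φ(ev) at
  -- G/H, which is the counit and hence a fibrewise retract.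
  refine (R.congr (fixedSpaceHomeo _ ⟨H⟩) (fixedSpaceHomeo A ⟨H⟩) fun x => ?_).isWeakHomotopyEquiv
  have h := fixedSpaceHomeo_naturality (evalApp A) ⟨H⟩ x
  rw [fixedPts_map_evalApp] at h
  exact h

end Evaluation

end Elmendorf

namespace Elmendorf

/-! ### The section of a fibrewise retract as homotopy inverse -/

section HomotopyInverse

/-- The section of a fibrewise retract is a homotopy inverse. -/
lemma FiberwiseRetract.comp_homotopic_id {X Y : Type u} [TopologicalSpace X] [TopologicalSpace Y]
    {f : C(X, Y)} (R : FiberwiseRetract f) :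
    (R.section'.comp f).Homotopic (ContinuousMap.id X) :=
  ContinuousMap.Homotopic.symm ⟨⟨R.homotopy.comp ContinuousMap.prodSwap,
    fun x => R.homotopy_zero x, fun x => R.homotopy_one x⟩⟩

lemma FiberwiseRetract.comp_section {X Y : Type u} [TopologicalSpace X] [TopologicalSpace Y]
    {f : C(X, Y)} (R : FiberwiseRetract f) : f.comp R.section' = ContinuousMap.id Y :=
  ContinuousMap.ext R.right_inv

end HomotopyInverse

end Elmendorf

theorem mainTheorem2 (G : Type u) [Group G] :
    ∃ (ε : elm G ⋙ fixedPts G ⟶ 𝟭 (OrbPsh G))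
      (ev : fixedPts G ⋙ elm G ⟶ 𝟭 (Action Cat.{u, u} G)),
      -- `ε (G/H, aH, x) = r_a^* x` on `L`-fixed triples
      (∀ (X : OrbPsh G) (L : Orb G) (y : ((fixedPts G).obj ((elm G).obj X)).obj (op L)),
        ((ε.app X).app (op L)).toFunctor.obj y
          = (X.map (rMap y).op).toFunctor.obj (triple y).elt) ∧
      -- `ε (f, h) = r_b^* h` for `(f, h) : (G/H, aH, x) → (G/K, bK, x')`
      (∀ (X : OrbPsh G) (L : Orb G) (y y' : ((fixedPts G).obj ((elm G).obj X)).obj (op L))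
        (φ : y ⟶ y'),
        HEq (((ε.app X).app (op L)).toFunctor.map φ)
          ((X.map (rMap y').op).toFunctor.map (Elm.homElt (tripleHom φ)))) ∧
      -- `ε` is a levelwise weak equivalence
      (∀ X : OrbPsh G, IsWeakEquivPsh (ε.app X)) ∧
      -- for each `X` and `L`, the explicit homotopy inverse `η` of `ε` at `G/L`
      (∀ (X : OrbPsh G) (L : Orb G),
        ∃ η : X.obj (op L) ⟶ ((fixedPts G).obj ((elm G).obj X)).obj (op L),
          -- `η x = (G/L, eL, x)` and `η f = (id, f)`
          η.toFunctor ⋙ evalOne ((elm G).obj X) L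
            = Grothendieck.ι ((forgetPt G).op ⋙ X) (op ⟨L, L.one⟩) ∧
          -- `ε ∘ η = id`
          η ≫ (ε.app X).app (op L) = 𝟙 (X.obj (op L)) ∧
          -- the maps `(r_a, id)` form a natural transformation `id ⇒ η ∘ ε`
          (∃ θ : 𝟭 _ ⟶ ((ε.app X).app (op L)).toFunctor ⋙ η.toFunctor,
            ∀ y, HEq (tripleHom (θ.app y))
              (Elm.homMk (X := X) (rMap y) (rMap_one y)
                (𝟙 ((X.map (rMap y).op).toFunctor.obj (triple y).elt)))) ∧
          -- `B ε` and `B η` are inverse up to homotopy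
          ((classifyingSpace.map ((ε.app X).app (op L))).hom.comp
            (classifyingSpace.map η).hom).Homotopic (ContinuousMap.id _) ∧
          ((classifyingSpace.map η).hom.comp
            (classifyingSpace.map ((ε.app X).app (op L))).hom).Homotopic (ContinuousMap.id _)) ∧
      -- `ev (G/H, aH, x) = a x`
      (∀ (A : Action Cat.{u, u} G) (H : Orb G) (a : G) (x : ((fixedPts G).obj A).obj (op H)),
        (ev.app A).hom.toFunctor.obj (Elm.mk (X := (fixedPts G).obj A) H (a : G ⧸ H.sub) x)
          = (act A a).obj ((evalOne A H).obj x)) ∧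
      -- `ev (f, h) = b h` for `(f, h) : (G/H, aH, x) → (G/K, bK, x')`
      (∀ (A : Action Cat.{u, u} G) (H K : Orb G) (a b : G)
        (x : ((fixedPts G).obj A).obj (op H)) (x' : ((fixedPts G).obj A).obj (op K))
        (φ : Elm.mk (X := (fixedPts G).obj A) H (a : G ⧸ H.sub) x ⟶
          Elm.mk (X := (fixedPts G).obj A) K (b : G ⧸ K.sub) x'),
        HEq ((ev.app A).hom.toFunctor.map φ)
          ((act A b).map ((evalOne A K).map (Elm.homElt φ)))) ∧
      -- `ev` is a weak equivalence of `G`-categories at every object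
      (∀ A : Action Cat.{u, u} G, IsWeakEquivGCat (ev.app A)) ∧
      -- `Φ ev = ε Φ`
      (∀ A : Action Cat.{u, u} G,
        (fixedPts G).map (ev.app A) = ε.app ((fixedPts G).obj A)) := by
  refine ⟨counit G, evalNat G, fun _ _ _ => rfl, fun _ _ _ _ φ => counitAt_map_heq φ,
    fun X U => (counitRetract X U.unop).isWeakHomotopyEquiv, fun X L => ⟨(unitAt X L).toCatHom,
      unitAt_comp_evalOne X L, Cat.ext unitAt_comp_counitAt,
      ⟨retractNat X L, fun y => heq_of_eq (tripleHom_retractNat y)⟩, ?_,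
      (counitRetract X L).comp_homotopic_id⟩,
    evalApp_obj, evalApp_map, isWeakEquivGCat_evalApp, fixedPts_map_evalApp⟩
  -- This composite is strictly the identity, so a constant homotopy is enough.
  exact (counitRetract X L).comp_section ▸ ContinuousMap.Homotopic.refl _
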